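/- For a bounded domain (connected open set) $\Omega\subset\mathbb{R}^2$ let $L^2_\circ(\Omega)=\{q\in L^2(\Omega):\int_\Omega q=0\}$, let $H^1_0(\Omega)$ be the closure of $\mathscr C^\infty_0(\Omega)$ in the Sobolev space $H^1(\Omega)$, and for $v=(v_1,v_2)\in H^1_0(\Omega)^2$ let $|v|_{1,\Omega}=\big(\sum_{k=1}^2\sum_{j=1}^2\|\partial_{x_j}v_k\|_{L^2(\Omega)}^2\big)^{1/2}$. The inf-sup constant of $\Omega$ is $$\beta(\Omega)=\inf_{q\in L^2_\circ(\Omega),\ q\neq 0}\ \sup_{v\in H^1_0(\Omega)^2,\ v\ne 0}\ \frac{\int_\Omega (\operatorname{div} v)\,q\,dx}{|v|_{1,\Omega}\,\|q\|_{L^2(\Omega)}}.$$ Theorem. Let $\Omega\subset\mathbb{R}^2$ be a domain contained in a ball of radius $R$ with center $x_0$, and star-shaped with respect to the concentric open ball $B$ of radius $\rho>0$ and center $x_0$, that is, $B\subset\Omega$ and every segment with one end in $B$ and the other in $\Omega$ is contained in $\Omega$. Then $$\beta(\Omega)\ \ge\ \frac{\rho}{\sqrt2\,R}\Big(1+\sqrt{1-\frac{\rho^2}{R^2}}\Big)^{-1/2}\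 \ge\ \frac{\rho}{2R}.$$ Equivalently, with $\psi=\frac{\pi}{2}-\arccos\frac{\rho}{R}$ one has $\beta(\Omega)\ge\sin\frac{\psi}{2}$, since $\sin\frac{\psi}{2}=\frac{\rho}{\sqrt2\,R}\big(1+\sqrt{1-\rho^2/R^2}\big)^{-1/2}$. -/

import Mathlib

open MeasureTheory TopologicalSpace Distributions
open scoped ContDiff

noncomputable section

/-- The Euclidean plane. -/
abbrev Plane : Type := EuclideanSpace ℝ (Fin 2)

/-- Lebesgue measure on the open set `Ω`. -/
abbrev domainMeasure (Ω : Opens Plane) : Measure Plane := volume.restrict (Ω : Set Plane)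

/-- The real Hilbert space `L²(Ω)`. -/
abbrev L2 (Ω : Opens Plane) : Type := Lp ℝ 2 (domainMeasure Ω)

/-- The classical partial derivative `∂ᵢ φ`. -/
def partialDeriv (i : Fin 2) (φ : Plane → ℝ) (x : Plane) : ℝ :=
  fderiv ℝ φ x (EuclideanSpace.single i 1)

/-- `g ∈ L²(Ω)` is the weak partial derivative `∂ᵢ v` of `v ∈ L²(Ω)` on `Ω`. -/
def IsWeakPartialDeriv {Ω : Opens Plane} (i : Fin 2) (v g : L2 Ω) : Prop :=
  ∀ φ : 𝓓(Ω, ℝ), ∫ x in Ω, v x * partialDeriv i φ x = -∫ x in Ω, g x * φ x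

/-- The Hilbert space of triples `(v, (g₀, g₁))` of `L²(Ω)` functions, with norm
`(‖v‖² + ‖g₀‖² + ‖g₁‖²)^(1/2)`. -/
abbrev L2Graph (Ω : Opens Plane) : Type := WithLp 2 (L2 Ω × PiLp 2 (fun _ : Fin 2 => L2 Ω))

theorem integrable_L2_mul {Ω : Opens Plane} (v : L2 Ω) {f : Plane → ℝ}
    (hf : Continuous f) (hc : HasCompactSupport f) :
    Integrable (fun x => v x * f x) (domainMeasure Ω) :=
  MemLp.integrable_mul (p := 2) (q := 2) (Lp.memLp v)
    ((hf.memLp_of_hasCompactSupport (μ := volume) hc).restrict _)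

theorem continuous_partialDeriv {Ω : Opens Plane} (i : Fin 2) (φ : 𝓓(Ω, ℝ)) :
    Continuous (partialDeriv i φ) :=
  (φ.contDiff.continuous_fderiv (by simp)).clm_apply continuous_const

theorem hasCompactSupport_partialDeriv {Ω : Opens Plane} (i : Fin 2) (φ : 𝓓(Ω, ℝ)) :
    HasCompactSupport (partialDeriv i φ) :=
  φ.hasCompactSupport.fderiv_apply ℝ _

theorem integral_L2_add_mul {Ω : Opens Plane} (v w : L2 Ω) {f : Plane → ℝ}
    (hf : Continuous f) (hc : HasCompactSupport f) :
    ∫ x in Ω, (v + w : L2 Ω) x * f x = (∫ x in Ω, v x * f x) + ∫ x in Ω, w x * f x := by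
  rw [← integral_add (integrable_L2_mul v hf hc) (integrable_L2_mul w hf hc)]
  refine integral_congr_ae ?_
  filter_upwards [Lp.coeFn_add v w] with x hx
  rw [hx, Pi.add_apply, add_mul]

theorem integral_L2_smul_mul {Ω : Opens Plane} (c : ℝ) (v : L2 Ω) (f : Plane → ℝ) :
    ∫ x in Ω, (c • v : L2 Ω) x * f x = c * ∫ x in Ω, v x * f x := by
  rw [← integral_const_mul]
  refine integral_congr_ae ?_
  filter_upwards [Lp.coeFn_smul c v] with x hx
  rw [hx, Pi.smul_apply, smul_eq_mul, mul_assoc]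

theorem IsWeakPartialDeriv.add {Ω : Opens Plane} {i : Fin 2} {v w g h : L2 Ω}
    (hv : IsWeakPartialDeriv i v g) (hw : IsWeakPartialDeriv i w h) :
    IsWeakPartialDeriv i (v + w) (g + h) := by
  intro φ
  rw [integral_L2_add_mul v w (continuous_partialDeriv i φ) (hasCompactSupport_partialDeriv i φ),
    integral_L2_add_mul g h φ.continuous φ.hasCompactSupport, hv φ, hw φ]
  ring

theorem IsWeakPartialDeriv.smul {Ω : Opens Plane} {i : Fin 2} {v g : L2 Ω} (c : ℝ)
    (hv : IsWeakPartialDeriv i v g) : IsWeakPartialDeriv i (c • v) (c • g) := by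
  intro φ
  rw [integral_L2_smul_mul, integral_L2_smul_mul, hv φ]
  ring

theorem IsWeakPartialDeriv.zero {Ω : Opens Plane} {i : Fin 2} :
    IsWeakPartialDeriv i (0 : L2 Ω) 0 := by
  intro φ
  have h (f : Plane → ℝ) : ∫ x in Ω, (0 : L2 Ω) x * f x = 0 := by
    have := integral_L2_smul_mul 0 (0 : L2 Ω) f
    rwa [zero_smul, zero_mul] at this
  rw [h, h, neg_zero]

/-- The Sobolev space `H¹(Ω)` with its usual norm. An element `v` is carried together with its
(unique) weak gradient, as the triple `(v, (∂₀ v, ∂₁ v))`. -/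
def H1 (Ω : Opens Plane) : Submodule ℝ (L2Graph Ω) where
  carrier := {u | ∀ i, IsWeakPartialDeriv i u.fst (u.snd i)}
  zero_mem' := fun _ => IsWeakPartialDeriv.zero
  add_mem' := fun hu hv i => (hu i).add (hv i)
  smul_mem' := fun c _ hu i => (hu i).smul c

/-- The function underlying an element of `H¹(Ω)`. -/
def H1.toL2 {Ω : Opens Plane} (u : H1 Ω) : L2 Ω := u.1.fst

/-- The weak partial derivative `∂ᵢ u` of `u ∈ H¹(Ω)`. -/
def H1.deriv {Ω : Opens Plane} (i : Fin 2) (u : H1 Ω) : L2 Ω := u.1.snd i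

/-- The elements of `H¹(Ω)` that are represented by test functions, `𝒞₀^∞(Ω) ⊆ H¹(Ω)`. -/
def testFunctionsInH1 (Ω : Opens Plane) : Set (H1 Ω) :=
  {u | ∃ φ : 𝓓(Ω, ℝ), H1.toL2 u =ᵐ[domainMeasure Ω] φ ∧
    ∀ i, H1.deriv i u =ᵐ[domainMeasure Ω] partialDeriv i φ}

/-- `H¹₀(Ω)`, the closure of `𝒞₀^∞(Ω)` in the norm of `H¹(Ω)`. -/
def H10 (Ω : Opens Plane) : Set (H1 Ω) := closure (testFunctionsInH1 Ω)

/-- The divergence `∂₀ v₀ + ∂₁ v₁` of a vector field `v ∈ H¹₀(Ω)²`. -/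
def divergence {Ω : Opens Plane} (v : Fin 2 → H10 Ω) : L2 Ω := ∑ i, H1.deriv i (v i).1

/-- `|v|_{1,Ω} = (∑ₖ ∑ⱼ ‖∂ⱼ vₖ‖²)^(1/2)`, the norm of `v ∈ H¹₀(Ω)²`. -/
def gradNorm {Ω : Opens Plane} (v : Fin 2 → H10 Ω) : ℝ :=
  √(∑ k, ∑ j, ‖H1.deriv j (v k).1‖ ^ 2)

/-- The inf-sup constant
`β(Ω) = inf_{q ∈ L²_∘(Ω)} sup_{v ∈ H¹₀(Ω)²} ⟨div v, q⟩ / (|v|_{1,Ω} ‖q‖_{0,Ω})`,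
the infimum and supremum being over those `q` and `v` for which the denominator is not zero;
they are taken in the extended reals. -/
def infSupConstant (Ω : Opens Plane) : EReal :=
  ⨅ (q : L2 Ω) (_ : ∫ x in Ω, q x = 0) (_ : ‖q‖ ≠ 0),
    ⨆ (v : Fin 2 → H10 Ω) (_ : gradNorm v ≠ 0),
      (((∫ x in Ω, divergence v x * q x) / (gradNorm v * ‖q‖) : ℝ) : EReal)

/-- `Ω` is star-shaped with respect to the open ball of centre `x₀` and radius `ρ`: the ball lies
in `Ω`, and so does every segment from a point of the ball to a point of `Ω`. -/
structure IsStarShapedWrtBall (Ω : Set Plane) (x₀ : Plane) (ρ : ℝ) : Prop where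
  ball_subset : Metric.ball x₀ ρ ⊆ Ω
  segment_subset : ∀ y ∈ Metric.ball x₀ ρ, ∀ x ∈ Ω, segment ℝ y x ⊆ Ω

end

/-! The bound follows from an inequality of Friedrichs type: if `h - i g` is holomorphic on `Ω` and
`h` has mean zero, then `(1 - u) ‖h‖² ≤ (1 + u) ‖g‖²`, where `u = √(1 - ρ²/R²) = cos ψ`. The
constant `√((1 - u) / 2)` this gives for `β` is `sin (ψ / 2)`.

From Friedrichs to inf-sup (`exists_infSup_of_friedrichs`): test fields satisfy `|∇w|² = |div w|² +
|curl w|²` after integration. Let `v` be the Riesz representative of `w ↦ ⟪q, div w⟫` in the closure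
of the test gradients, `p = div v`, `g = curl v`. Then `⟪q - p, div w⟫ = ⟪g, curl w⟫` for all test
fields `w`, which are the Cauchy-Riemann equations for `(q - p) - i g` in the weak sense. Friedrichs
and Cauchy-Schwarz then bound `‖q‖` by `‖v‖`.

Friedrichs itself (`friedrichs_holomorphic`): let `N` be the gauge of the domain centred at `0`.
Star-shapedness with respect to the ball makes `N` Lipschitz with constant `1/ρ`, and containment in
the large ball gives `‖z‖ ≤ R N z`. If `F` is holomorphic with `F 0 = i c`, then `G = (F² + c²) / z`
is holomorphic, and its conjugate is a divergence-free field. Testing that field with a truncation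
of `-N²/2` gives an integral that vanishes. `friedrichs_pointwise` compares its integrand, at almost
every point, with `(1 - u) (Re F)² - (1 + u) (Im F)²`.

Weak solutions are reached by mollifying on the sublevel sets `N < 1 - κ` and letting `κ → 0`. The
normalisation `Re F 0 = 0` is exchanged for mean zero through the double integral of `(h x - h y)²`.
-/

/-! ### The gauge of a set star-shaped with respect to a ball -/

section Gauge

open scoped Pointwise

variable {E : Type*} [NormedAddCommGroup E] [NormedSpace ℝ E] {S : Set E} {ρ : ℝ}

/-- Without convexity the gauge need not be subadditive, but here one summand can be scaled into the
ball. If `x = a • s` with `s ∈ S` and `y = b • y'` with `y'` in the ball, then `(x + y) / (a + b)`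
lies on the segment from `y'` to `s`, hence in `S`. -/
theorem gauge_add_le_of_segment_subset (hρ : 0 < ρ) (hb : Metric.ball 0 ρ ⊆ S)
    (hs : ∀ y ∈ Metric.ball (0 : E) ρ, ∀ x ∈ S, segment ℝ y x ⊆ S) (x y : E) :
    gauge S (x + y) ≤ gauge S x + ‖y‖ / ρ := by
  have habs : Absorbent ℝ S := absorbent_nhds_zero (Filter.mem_of_superset (Metric.ball_mem_nhds _ hρ) hb)
  refine le_of_forall_pos_le_add fun ε hε => ?_
  obtain ⟨a, ha, hax, s, hsS, rfl⟩ :=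
    exists_lt_of_gauge_lt habs (show gauge S x < gauge S x + ε / 2 by linarith)
  set b := ‖y‖ / ρ + ε / 2 with hbdef
  have hbpos : 0 < b := by positivity
  have hy' : b⁻¹ • y ∈ Metric.ball (0 : E) ρ := by
    rw [mem_ball_zero_iff, norm_smul, norm_inv, Real.norm_of_nonneg hbpos.le, inv_mul_lt_iff₀ hbpos,
      hbdef, add_mul, div_mul_cancel₀ _ hρ.ne']
    have : 0 < ε / 2 * ρ := by positivity
    linarith
  have hmem : a • s + y ∈ (a + b) • S := by
    refine ⟨(b / (a + b)) • (b⁻¹ • y) + (a / (a + b)) • s, hs _ hy' s hsS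
      ⟨b / (a + b), a / (a + b), by positivity, by positivity, by field_simp; ring, rfl⟩, ?_⟩
    simp only [smul_add, smul_smul]
    rw [add_comm]
    congr 1
    · congr 1; field_simp
    · conv_rhs => rw [← one_smul ℝ y]
      congr 1; field_simp
  have := gauge_le_of_mem (by positivity) hmem
  simp only at hax this ⊢
  linarith

theorem lipschitzWith_gauge_of_segment_subset (hρ : 0 < ρ) (hb : Metric.ball 0 ρ ⊆ S)
    (hs : ∀ y ∈ Metric.ball (0 : E) ρ, ∀ x ∈ S, segment ℝ y x ⊆ S) :
    LipschitzWith (ρ⁻¹).toNNReal (gauge S) := by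
  refine LipschitzWith.of_le_add_mul _ fun x y => ?_
  have := gauge_add_le_of_segment_subset hρ hb hs y (x - y)
  rw [Real.coe_toNNReal _ (by positivity), dist_eq_norm, mul_comm, ← div_eq_mul_inv]
  simpa using this

theorem gauge_lt_one_iff_mem_of_isOpen (hS : IsOpen S) (h0 : (0 : E) ∈ S)
    (hs : ∀ x ∈ S, segment ℝ 0 x ⊆ S) {x : E} : gauge S x < 1 ↔ x ∈ S := by
  refine ⟨fun h => ?_, gauge_lt_one_of_mem_of_isOpen hS⟩
  obtain ⟨y, hy, hx⟩ := mem_openSegment_of_gauge_lt_one (absorbent_nhds_zero (hS.mem_nhds h0)) h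
  exact hs y hy (openSegment_subset_segment _ _ _ hx)

end Gauge

/-! ### The pointwise inequality -/

theorem quadratic_form_nonneg {A B C h g : ℝ} (hA : 0 ≤ A) (hC : 0 ≤ C) (hB : B ^ 2 ≤ A * C) :
    0 ≤ A * h ^ 2 - 2 * B * (h * g) + C * g ^ 2 := by
  rcases hA.eq_or_lt with rfl | hA
  · have : B = 0 := by nlinarith
    subst this; nlinarith [mul_nonneg hC (sq_nonneg g)]
  · have : 0 ≤ A * (A * h ^ 2 - 2 * B * (h * g) + C * g ^ 2) := by
      nlinarith [sq_nonneg (A * h - B * g), mul_nonneg (sub_nonneg.2 hB) (sq_nonneg g)]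
    exact nonneg_of_mul_nonneg_right this hA

/-- The pointwise form of the Friedrichs inequality: `n` is the value of the gauge at `x + i y`,
`(a, b)` its gradient, `h + i g` the value of the holomorphic function `F` and `p + i q` the value
of `(F² + c²) / z`. -/
theorem friedrichs_pointwise {x y n a b h g p q c ρ R u : ℝ} (hu0 : 0 ≤ u) (hu1 : u ≤ 1)
    (hρ : ρ ^ 2 = R ^ 2 * (1 - u ^ 2)) (hr : 0 < x ^ 2 + y ^ 2)
    (heuler : x * a + y * b = n) (hab : (a ^ 2 + b ^ 2) * ρ ^ 2 ≤ 1)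
    (hn : x ^ 2 + y ^ 2 ≤ R ^ 2 * n ^ 2)
    (h1 : x * p - y * q = h ^ 2 - g ^ 2 + c ^ 2) (h2 : x * q + y * p = 2 * h * g) :
    (1 - u) * h ^ 2 - (1 + u) * g ^ 2 ≤ ρ ^ 2 * (n * (a * p - b * q)) := by
  set r := x ^ 2 + y ^ 2 with hrdef
  -- Here `n` is the radial derivative of the gauge and `w` its angular derivative, both scaled by
  -- `|z|`; so `n² + w² = r |∇N|²`.
  set w := x * b - y * a with hw
  have hnw : n ^ 2 + w ^ 2 = r * (a ^ 2 + b ^ 2) := by rw [← heuler, hw, hrdef]; ring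
  have hkey : r * (a * p - b * q) = n * (h ^ 2 - g ^ 2 + c ^ 2) - w * (2 * h * g) := by
    rw [← h1, ← h2, ← heuler, hw, hrdef]; ring
  set T := ρ ^ 2 * n ^ 2 with hT
  have hT0 : 0 ≤ T := by positivity
  have hTr : T + ρ ^ 2 * w ^ 2 ≤ r := by
    have : ρ ^ 2 * (n ^ 2 + w ^ 2) ≤ r := by rw [hnw]; nlinarith
    linarith
  have hw0 : 0 ≤ ρ ^ 2 * w ^ 2 := by positivity
  have hTlow : (1 - u ^ 2) * r ≤ T := by
    have : (1 - u ^ 2) * r ≤ (1 - u ^ 2) * (R ^ 2 * n ^ 2) :=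
      mul_le_mul_of_nonneg_left hn (by nlinarith)
    rw [hT, hρ]; linarith
  have hA : 0 ≤ T - (1 - u) * r := by nlinarith [mul_nonneg (mul_nonneg hu0 (sub_nonneg.2 hu1)) hr.le]
  have hC : 0 ≤ (1 + u) * r - T := by nlinarith [mul_nonneg hu0 hr.le]
  -- The left side is at most `T (r - T)`, and the right side exceeds `T (r - T)` by exactly `r (T -
  -- (1 - u²) r)`, which is nonnegative by `hTlow`.
  have hB : (ρ ^ 2 * n * w) ^ 2 ≤ (T - (1 - u) * r) * ((1 + u) * r - T) := by
    have e : (ρ ^ 2 * n * w) ^ 2 = T * (ρ ^ 2 * w ^ 2) := by rw [hT]; ring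
    rw [e]
    nlinarith [mul_le_mul_of_nonneg_left hTr hT0, mul_le_mul_of_nonneg_left hTlow hr.le]
  have hform := quadratic_form_nonneg (h := h) (g := g) hA hC hB
  have hc : 0 ≤ T * c ^ 2 := by positivity
  refine le_of_mul_le_mul_left ?_ hr
  have : r * (ρ ^ 2 * (n * (a * p - b * q))) = ρ ^ 2 * n * (r * (a * p - b * q)) := by ring
  rw [this, hkey]
  have e : ρ ^ 2 * n * (n * (h ^ 2 - g ^ 2 + c ^ 2) - w * (2 * h * g)) =
    T * (h ^ 2 - g ^ 2 + c ^ 2) - ρ ^ 2 * n * w * (2 * h * g) := by rw [hT]; ring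
  rw [e]
  linarith

/-! ### The Friedrichs inequality for holomorphic functions -/

theorem exists_contDiff_cutoff {K U : Set ℂ} (hK : IsCompact K) (hU : IsOpen U) (hKU : K ⊆ U) :
    ∃ χ : ℂ → ℝ, ContDiff ℝ ∞ χ ∧ HasCompactSupport χ ∧ (∀ z ∉ U, ∀ᶠ w in nhds z, χ w = 0) ∧
      ∀ z ∈ K, ∀ᶠ w in nhds z, χ w = 1 := by
  obtain ⟨M, hM⟩ := hK.isBounded.subset_ball 0
  obtain ⟨χ, h0, h1, -⟩ := exists_contMDiffMap_zero_one_nhds_of_isClosed (n := (⊤ : ℕ∞)) (modelWithCornersSelf ℝ ℂ)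
    (s := (U ∩ Metric.ball 0 M)ᶜ) (t := K) (hU.inter Metric.isOpen_ball).isClosed_compl
    hK.isClosed (Set.disjoint_compl_left_iff_subset.2 (Set.subset_inter hKU hM))
  rw [eventually_nhdsSet_iff_forall] at h0 h1
  refine ⟨χ, χ.contMDiff.contDiff, HasCompactSupport.of_support_subset_isCompact
    (isCompact_closedBall 0 M) ?_, fun z hz => h0 z fun h => hz h.1, h1⟩
  intro z hz
  by_contra hzM
  exact hz (h0 z fun h => hzM (Metric.ball_subset_closedBall h.2)).self_of_nhds

theorem lineDeriv_eq_zero_of_notMem_tsupport {f : ℂ → ℝ} {z : ℂ} (hz : z ∉ tsupport f) (v : ℂ) :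
    lineDeriv ℝ f z v = 0 := by
  rw [(notMem_tsupport_iff_eventuallyEq.1 hz).lineDeriv_eq]
  simp [lineDeriv]

/-- The conjugate of a holomorphic function is a divergence-free vector field. -/
theorem integral_lineDeriv_mul_holomorphic {ζ : ℂ → ℝ} {C : NNReal} (hζ : LipschitzWith C ζ)
    (hc : HasCompactSupport ζ) {U : Set ℂ} (hU : IsOpen U) (hsub : tsupport ζ ⊆ U) {G : ℂ → ℂ}
    (hG : DifferentiableOn ℂ G U) :
    Integrable (fun z => lineDeriv ℝ ζ z 1 * (G z).re - lineDeriv ℝ ζ z Complex.I * (G z).im) ∧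
      ∫ z, (lineDeriv ℝ ζ z 1 * (G z).re - lineDeriv ℝ ζ z Complex.I * (G z).im) = 0 := by
  -- Cutting `G` off outside a neighbourhood of the support of `ζ` gives a `C¹` function on the
  -- whole plane, so that integration by parts for Lipschitz functions applies.
  obtain ⟨χ, hχ, hχc, hχ0, hχ1⟩ := exists_contDiff_cutoff hc.isCompact hU hsub
  set H : ℂ → ℂ := fun z => χ z • G z with hH
  have hHsmooth : ContDiff ℝ 1 H := by
    rw [contDiff_iff_contDiffAt]
    intro z
    by_cases hz : z ∈ U
    · exact (hχ.of_le (by simp)).contDiffAt.smul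
        ((hG.contDiffOn hU (n := 1)).contDiffAt (hU.mem_nhds hz) |>.restrict_scalars ℝ)
    · refine contDiffAt_const (c := 0) |>.congr_of_eventuallyEq ?_
      filter_upwards [hχ0 z hz] with w hw
      simp [hH, hw]
  have hHc : HasCompactSupport H := hχc.smul_right
  have hHG : ∀ z ∈ tsupport ζ, ∀ᶠ w in nhds z, H w = G w := fun z hz => by
    filter_upwards [hχ1 z hz] with w hw
    simp [hH, hw]
  have hpc : HasCompactSupport fun z => (H z).re := hHc.comp_left (g := Complex.re) rfl
  have hqc : HasCompactSupport fun z => (H z).im := hHc.comp_left (g := Complex.im) rfl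
  obtain ⟨P, hP⟩ := (Complex.reCLM.contDiff.comp hHsmooth).lipschitzWith_of_hasCompactSupport hpc one_ne_zero
  obtain ⟨Q, hQ⟩ := (Complex.imCLM.contDiff.comp hHsmooth).lipschitzWith_of_hasCompactSupport hqc one_ne_zero
  have hcongr : (fun z => lineDeriv ℝ ζ z 1 * (G z).re - lineDeriv ℝ ζ z Complex.I * (G z).im) =
      fun z => lineDeriv ℝ ζ z 1 * (H z).re - lineDeriv ℝ ζ z Complex.I * (H z).im := by
    funext z
    by_cases hz : z ∈ tsupport ζ
    · rw [(hHG z hz).self_of_nhds]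
    · simp [lineDeriv_eq_zero_of_notMem_tsupport hz]
  have hint (v : ℂ) {f : ℂ → ℝ} (hf : Continuous f) (hfc : HasCompactSupport f) :
      Integrable (fun z => lineDeriv ℝ ζ z v * f z) :=
    (hf.integrable_of_hasCompactSupport hfc).bdd_mul
      (measurable_lineDeriv hζ.continuous).aestronglyMeasurable
      (Filter.Eventually.of_forall fun z => norm_lineDeriv_le_of_lipschitz ℝ hζ)
  have i1 := hint 1 hP.continuous hpc
  have i2 := hint Complex.I hQ.continuous hqc
  rw [hcongr]
  refine ⟨i1.sub i2, ?_⟩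
  rw [integral_sub i1 i2, sub_eq_zero]
  have e1 := hP.integral_lineDeriv_mul_eq (μ := volume) hζ hc (-1)
  have e2 := hQ.integral_lineDeriv_mul_eq (μ := volume) hζ hc (-Complex.I)
  rw [neg_neg] at e1 e2
  -- After integration by parts both integrands are `-ζ Re G'`: this is the Cauchy-Riemann equation
  -- `∂ₓ Re G = ∂ᵧ Im G`.
  refine e1.symm.trans (Eq.trans ?_ e2)
  refine integral_congr_ae (Filter.Eventually.of_forall fun z => ?_)
  dsimp only
  by_cases hz : z ∈ tsupport ζ
  · have hd : HasFDerivAt G _ z :=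
      ((hG.differentiableAt (hU.mem_nhds (hsub hz))).hasDerivAt.hasFDerivAt.restrictScalars ℝ)
    have hd' := hd.congr_of_eventuallyEq (hHG z hz)
    have r1 : lineDeriv ℝ (fun z => (H z).re) z (-1) = _ :=
      ((Complex.reCLM.hasFDerivAt.comp z hd').hasLineDerivAt (-1)).lineDeriv
    have r2 : lineDeriv ℝ (fun z => (H z).im) z (-Complex.I) = _ :=
      ((Complex.imCLM.hasFDerivAt.comp z hd').hasLineDerivAt (-Complex.I)).lineDeriv
    rw [r1, r2]
    simp
  · simp [image_eq_zero_of_notMem_tsupport hz]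

/-- Stated for a sublevel set `N < t` with `F` holomorphic near its closure, so that every integral
converges. Of the gauge only homogeneity, the Lipschitz bound and `‖z‖ ≤ R N z` matter. -/
theorem friedrichs_holomorphic {N : ℂ → ℝ} {ρ R u t : ℝ} (hρ : 0 < ρ) (hu0 : 0 ≤ u) (hu1 : u ≤ 1)
    (hρR : ρ ^ 2 = R ^ 2 * (1 - u ^ 2)) (hN : LipschitzWith (ρ⁻¹).toNNReal N) (hN0 : ∀ z, 0 ≤ N z)
    (hhom : ∀ c : ℝ, 0 ≤ c → ∀ z, N (c • z) = c * N z) (hNR : ∀ z, ‖z‖ ≤ R * N z) (ht : 0 < t)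
    {U : Set ℂ} (hU : IsOpen U) (hKU : {z | N z ≤ t} ⊆ U) {F : ℂ → ℂ} (hF : DifferentiableOn ℂ F U)
    (hF0 : (F 0).re = 0) :
    (1 - u) * ∫ z in {z | N z < t}, (F z).re ^ 2 ≤ (1 + u) * ∫ z in {z | N z < t}, (F z).im ^ 2 := by
  have hNzero : N 0 = 0 := by simpa using hhom 0 le_rfl 0
  have hR : 0 ≤ R := by
    by_contra hR
    have := hNR 1
    rw [norm_one] at this
    nlinarith [hN0 1]
  -- Chosen so that `∇ζ = -N ∇N` where `N < t` and `ζ = 0` elsewhere.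
  set ζ : ℂ → ℝ := fun z => (t ^ 2 - min (N z) t ^ 2) / 2 with hζ
  have hmin := hN.min_const t
  have hζlip : LipschitzWith (t.toNNReal * (ρ⁻¹).toNNReal) ζ := by
    refine LipschitzWith.of_dist_le_mul fun z w => ?_
    have h1 := hmin.dist_le_mul z w
    have hz0 : 0 ≤ min (N z) t := le_min (hN0 z) ht.le
    have hw0 : 0 ≤ min (N w) t := le_min (hN0 w) ht.le
    have hz1 : min (N z) t ≤ t := min_le_right _ _
    have hw1 : min (N w) t ≤ t := min_le_right _ _
    rw [NNReal.coe_mul, Real.coe_toNNReal t ht.le, mul_assoc]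
    rw [Real.dist_eq] at h1 ⊢
    have e : ζ z - ζ w = (min (N w) t - min (N z) t) * ((min (N w) t + min (N z) t) / 2) := by
      simp only [hζ]; ring
    rw [e, abs_mul, abs_sub_comm, abs_of_nonneg (a := (_ + _) / 2) (by positivity), mul_comm t]
    exact mul_le_mul h1 (by linarith) (by positivity) ((abs_nonneg _).trans h1)
  have hK : IsCompact {z | N z ≤ t} := by
    refine (isCompact_closedBall (0 : ℂ) (R * t)).of_isClosed_subset
      (isClosed_le hN.continuous continuous_const) fun z hz => ?_
    rw [mem_closedBall_zero_iff]
    exact (hNR z).trans (mul_le_mul_of_nonneg_left hz hR)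
  have hζ0 : ∀ z, t ≤ N z → ζ z = 0 := fun z hz => by simp [hζ, min_eq_right hz]
  have hζsupp : tsupport ζ ⊆ {z | N z ≤ t} := by
    refine closure_minimal (fun z hz => ?_) hK.isClosed
    by_contra h
    exact hz (hζ0 z (not_le.1 h).le)
  have hζc : HasCompactSupport ζ := hK.of_isClosed_subset (isClosed_tsupport _) hζsupp
  set c := (F 0).im with hc
  set H : ℂ → ℂ := dslope F 0 with hHdef
  have h0U : U ∈ nhds (0 : ℂ) := hU.mem_nhds (hKU (by simpa [hNzero] using ht.le))
  have hH : DifferentiableOn ℂ H U := (Complex.differentiableOn_dslope h0U).2 hF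
  have hFH : ∀ z, F z = z * H z + c * Complex.I := fun z => by
    have := sub_smul_dslope F 0 z
    rw [sub_zero, smul_eq_mul] at this
    rw [hHdef, this, hc, ← sub_eq_iff_eq_add', sub_sub_cancel]
    refine Complex.ext ?_ ?_ <;> simp [hF0]
  -- This is `(F² + c²) / z` with the singularity removed: substitute `F = z H + i c`.
  set G : ℂ → ℂ := fun z => z * H z ^ 2 + 2 * c * Complex.I * H z with hGdef
  have hG : DifferentiableOn ℂ G U :=
    (differentiableOn_id.mul (hH.pow 2)).add (hH.const_mul (2 * c * Complex.I))
  have hGF : ∀ z, z * G z = F z ^ 2 + c ^ 2 := fun z => by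
    rw [hFH z, hGdef]; ring_nf; rw [Complex.I_sq]; ring
  obtain ⟨hint, hzero⟩ := integral_lineDeriv_mul_holomorphic hζlip hζc hU (hζsupp.trans hKU) hG
  set k : ℂ → ℝ := fun z => lineDeriv ℝ ζ z 1 * (G z).re - lineDeriv ℝ ζ z Complex.I * (G z).im
  have hmeas : MeasurableSet {z | N z < t} := measurableSet_lt hN.continuous.measurable measurable_const
  have hFc : ContinuousOn F {z | N z ≤ t} := hF.continuousOn.mono hKU
  have hire : IntegrableOn (fun z => (F z).re ^ 2) {z | N z < t} :=
    (((Complex.continuous_re.comp_continuousOn hFc).pow 2).integrableOn_compact hK).mono_set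
      fun z (hz : N z < t) => show N z ≤ t from hz.le
  have hiim : IntegrableOn (fun z => (F z).im ^ 2) {z | N z < t} :=
    (((Complex.continuous_im.comp_continuousOn hFc).pow 2).integrableOn_compact hK).mono_set
      fun z (hz : N z < t) => show N z ≤ t from hz.le
  have hiall := (hire.const_mul (1 - u)).sub (hiim.const_mul (1 + u))
  -- Since `ζ ≥ 0` vanishes at `z`, the point is a minimum along every line. This covers the level
  -- set `N = t` too, where `N` may fail to be differentiable.
  have hoff : ∀ z, t ≤ N z → ∀ v, lineDeriv ℝ ζ z v = 0 := fun z hz v => by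
    refine IsLocalMin.deriv_eq_zero (Filter.Eventually.of_forall fun s => ?_)
    have : 0 ≤ ζ (z + s • v) := by
      have h1 : min (N (z + s • v)) t ≤ t := min_le_right _ _
      have h2 : 0 ≤ min (N (z + s • v)) t := le_min (hN0 _) ht.le
      simp only [hζ]
      nlinarith
    simpa [hζ0 z hz] using this
  have hon : ∀ z, N z < t → DifferentiableAt ℝ N z → ∀ v,
      lineDeriv ℝ ζ z v = -(N z * fderiv ℝ N z v) := fun z hz hd v => by
    have hev : ζ =ᶠ[nhds z] fun w => (t ^ 2 - N w ^ 2) / 2 := by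
      filter_upwards [hN.continuous.continuousAt.eventually_lt continuousAt_const hz] with w hw
      simp [hζ, min_eq_left hw.le]
    rw [hev.lineDeriv_eq]
    have h1 : HasDerivAt (fun s : ℝ => N (z + s • v)) (fderiv ℝ N z v) 0 :=
      hd.hasFDerivAt.hasLineDerivAt v
    have h2 := ((h1.pow 2).const_sub (t ^ 2)).div_const 2
    refine HasDerivAt.deriv (h2.congr_deriv ?_)
    simp; ring
  have hpt : ∀ᵐ z, Set.indicator {z | N z < t}
      (fun z => (1 - u) * (F z).re ^ 2 - (1 + u) * (F z).im ^ 2) z ≤ -(ρ ^ 2) * k z := by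
    filter_upwards [hN.ae_differentiableAt, compl_mem_ae_iff.2 (measure_singleton (0 : ℂ))] with z hd hz0
    by_cases hz : N z < t
    · rw [Set.indicator_of_mem (by exact hz)]
      simp only [k, hon z hz hd]
      -- Euler's relation: differentiate `N ((1 + s) z) = (1 + s) N z` at `s = 0`.
      have heuler : fderiv ℝ N z z = N z := by
        have h1 : HasDerivAt (fun s : ℝ => N (z + s • z)) (fderiv ℝ N z z) 0 :=
          hd.hasFDerivAt.hasLineDerivAt z
        have h2 : HasDerivAt (fun s : ℝ => (1 + s) * N z) (1 * N z) 0 :=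
          ((hasDerivAt_id (0 : ℝ)).const_add 1).mul_const (N z)
        rw [one_mul] at h2
        refine h1.unique (h2.congr_of_eventuallyEq ?_)
        filter_upwards [lt_mem_nhds (show (-1 : ℝ) < 0 by norm_num)] with s hs
        rw [← hhom (1 + s) (by linarith), add_smul, one_smul]
      have hLz : ∀ w : ℂ, fderiv ℝ N z w = w.re * fderiv ℝ N z 1 + w.im * fderiv ℝ N z Complex.I :=
        fun w => by
        conv_lhs => rw [show w = w.re • (1 : ℂ) + w.im • Complex.I by simp [Complex.re_add_im]]
        rw [map_add, map_smul, map_smul, smul_eq_mul, smul_eq_mul]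
      set a := fderiv ℝ N z 1
      set b := fderiv ℝ N z Complex.I
      have hnorm : (a ^ 2 + b ^ 2) * ρ ^ 2 ≤ 1 := by
        -- The derivative is evaluated at the gradient `a + i b` itself, which turns the operator
        -- norm bound into `|∇N| ≤ 1/ρ`.
        have h1 := (fderiv ℝ N z).le_of_opNorm_le (norm_fderiv_le_of_lipschitz ℝ hN) ⟨a, b⟩
        rw [hLz, Real.coe_toNNReal _ (by positivity), Real.norm_eq_abs] at h1
        have h2 := (le_abs_self _).trans h1
        have h3 : ‖(⟨a, b⟩ : ℂ)‖ ^ 2 = a ^ 2 + b ^ 2 := by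
          rw [← Complex.normSq_eq_norm_sq, Complex.normSq_mk]; ring
        set m := ‖(⟨a, b⟩ : ℂ)‖
        have hm : 0 ≤ m := norm_nonneg _
        have h4 : m ^ 2 * ρ ≤ m := by
          rw [h3]
          have := mul_le_mul_of_nonneg_right h2 hρ.le
          rw [mul_comm (ρ⁻¹), mul_assoc, inv_mul_cancel₀ hρ.ne', mul_one] at this
          linarith
        have h5 : m * ρ ≤ 1 := by
          rcases hm.eq_or_lt with h | h
          · rw [← h]; simp
          · have : m * (m * ρ) ≤ m * 1 := by linarith
            exact le_of_mul_le_mul_left this h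
        rw [← h3, ← mul_pow]
        exact pow_le_one₀ (by positivity) h5
      have hre := congrArg Complex.re (hGF z)
      have him := congrArg Complex.im (hGF z)
      have hr : z.re ^ 2 + z.im ^ 2 = ‖z‖ ^ 2 := by
        rw [← Complex.normSq_eq_norm_sq, Complex.normSq_apply]; ring
      have := friedrichs_pointwise (x := z.re) (y := z.im) (n := N z) (a := a) (b := b)
        (h := (F z).re) (g := (F z).im) (p := (G z).re) (q := (G z).im) (c := c) hu0 hu1 hρR
        (by rw [hr]; exact pow_pos (norm_pos_iff.2 hz0) 2) (by rw [← heuler, hLz])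
        hnorm (by rw [hr, ← mul_pow]; exact pow_le_pow_left₀ (norm_nonneg _) (hNR z) 2)
        (by simpa [pow_two] using hre) (by simp [pow_two] at him; linarith)
      linarith
    · rw [Set.indicator_of_notMem (by exact hz)]
      simp [k, hoff z (not_lt.1 hz)]
  have hmono := integral_mono_ae (IntegrableOn.integrable_indicator hiall hmeas) (hint.const_mul (-(ρ ^ 2))) hpt
  rw [integral_const_mul, hzero, mul_zero, integral_indicator hmeas] at hmono
  have hsub := integral_sub (hire.const_mul (1 - u)) (hiim.const_mul (1 + u))
  rw [integral_const_mul, integral_const_mul] at hsub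
  change (∫ a in {z | N z < t}, ((1 - u) * (F a).re ^ 2 - (1 + u) * (F a).im ^ 2)) ≤ 0 at hmono
  rw [hsub] at hmono
  linarith

/-! ### Mollification of weakly holomorphic pairs -/

section Mollification

open scoped Convolution

variable (φ : ContDiffBump (0 : ℂ)) {f h g : ℂ → ℝ}

/-- The convolution of `f` with the normalised bump function `φ`. -/
noncomputable def mollify (f : ℂ → ℝ) : ℂ → ℝ :=
  φ.normed volume ⋆[ContinuousLinearMap.lsmul ℝ ℝ, volume] f

theorem mollify_apply (f : ℂ → ℝ) (x : ℂ) :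
    mollify φ f x = ∫ y, φ.normed volume (x - y) * f y := by
  rw [mollify, convolution_lsmul_swap]
  rfl

theorem contDiff_mollify (hf : LocallyIntegrable f) : ContDiff ℝ 1 (mollify φ f) :=
  φ.hasCompactSupport_normed.contDiff_convolution_left (n := 1) _ φ.contDiff_normed hf

theorem integrable_normed_sub_mul (hf : LocallyIntegrable f) (x : ℂ) :
    Integrable fun y => φ.normed volume (x - y) * f y :=
  (φ.hasCompactSupport_normed.convolutionExists_left (ContinuousLinearMap.lsmul ℝ ℝ)
    φ.continuous_normed hf x).integrable_swap

theorem fderiv_mollify (hf : LocallyIntegrable f) (x v : ℂ) :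
    fderiv ℝ (mollify φ f) x v = ∫ y, f y * fderiv ℝ (φ.normed volume) (x - y) v := by
  have e : mollify φ f = f ⋆[ContinuousLinearMap.lsmul ℝ ℝ, volume] φ.normed volume := by
    funext z
    rw [mollify_apply, convolution_lsmul]
    simp_rw [smul_eq_mul, mul_comm]
  rw [e, (φ.hasCompactSupport_normed.hasFDerivAt_convolution_right (ContinuousLinearMap.lsmul ℝ ℝ)
    hf φ.contDiff_normed x).fderiv, convolution_precompR_apply _ hf
    (φ.hasCompactSupport_normed.fderiv ℝ) ((φ.contDiff_normed (n := 1)).continuous_fderiv one_ne_zero)]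
  rfl

theorem hasCompactSupport_normed_sub (x : ℂ) :
    HasCompactSupport fun y => φ.normed volume (x - y) :=
  φ.hasCompactSupport_normed.comp_homeomorph (Homeomorph.subLeft x)

theorem contDiff_normed_sub (x : ℂ) : ContDiff ℝ ∞ fun y => φ.normed volume (x - y) :=
  φ.contDiff_normed.comp (contDiff_const.sub contDiff_id)

theorem tsupport_normed_sub (x : ℂ) :
    tsupport (fun y => φ.normed volume (x - y)) ⊆ Metric.closedBall x φ.rOut := by
  refine closure_minimal (fun y hy => ?_) Metric.isClosed_closedBall
  have : x - y ∈ Function.support (φ.normed volume) := hy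
  rw [φ.support_normed_eq, mem_ball_zero_iff] at this
  rw [Metric.mem_closedBall, dist_comm, dist_eq_norm]
  exact this.le

theorem fderiv_normed_sub (x y v : ℂ) :
    fderiv ℝ (fun y => φ.normed volume (x - y)) y v = -fderiv ℝ (φ.normed volume) (x - y) v := by
  have h1 : HasFDerivAt (φ.normed volume) (fderiv ℝ (φ.normed volume) (x - y)) (x - y) :=
    ((φ.contDiff_normed (n := 1)).differentiable one_ne_zero _).hasFDerivAt
  have h2 : HasFDerivAt (fun y : ℂ => x - y) (-ContinuousLinearMap.id ℝ ℂ) y :=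
    (hasFDerivAt_id y).const_sub x
  rw [show (fun y => φ.normed volume (x - y)) = φ.normed volume ∘ (fun y => x - y) from rfl,
    (h1.comp y h2).fderiv]
  simp

/-- `h - i g` satisfies the Cauchy-Riemann equations on `S` in the sense of distributions. -/
def IsWeaklyHolomorphicOn (S : Set ℂ) (h g : ℂ → ℝ) : Prop :=
  ∀ ψ : ℂ → ℝ, ContDiff ℝ ∞ ψ → HasCompactSupport ψ → tsupport ψ ⊆ S →
    ∫ z, h z * fderiv ℝ ψ z 1 = -∫ z, g z * fderiv ℝ ψ z Complex.I ∧
    ∫ z, h z * fderiv ℝ ψ z Complex.I = ∫ z, g z * fderiv ℝ ψ z 1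

/-- The translate `y ↦ φ (x - y)` is an admissible test function when the ball around `x` lies in
`S`; tested with it, the weak equations become the pointwise Cauchy-Riemann equations of the
mollified functions at `x`. -/
theorem IsWeaklyHolomorphicOn.differentiableAt {S : Set ℂ} (H : IsWeaklyHolomorphicOn S h g)
    (hh : LocallyIntegrable h) (hg : LocallyIntegrable g) {x : ℂ}
    (hx : Metric.closedBall x φ.rOut ⊆ S) :
    DifferentiableAt ℂ (fun z => (mollify φ h z : ℂ) - mollify φ g z * Complex.I) x := by
  obtain ⟨h1, h2⟩ := H _ (contDiff_normed_sub φ x) (hasCompactSupport_normed_sub φ x)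
    ((tsupport_normed_sub φ x).trans hx)
  simp only [fderiv_normed_sub, mul_neg, integral_neg] at h1 h2
  rw [← fderiv_mollify φ hh, ← fderiv_mollify φ hg] at h1 h2
  have dh := ((contDiff_mollify φ hh).differentiable one_ne_zero x).hasFDerivAt
  have dg := ((contDiff_mollify φ hg).differentiable one_ne_zero x).hasFDerivAt
  have d := (Complex.ofRealCLM.hasFDerivAt.comp x dh).sub
    ((Complex.ofRealCLM.hasFDerivAt.comp x dg).mul_const Complex.I)
  have d' : HasFDerivAt (fun z => (mollify φ h z : ℂ) - mollify φ g z * Complex.I) _ x := d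
  refine differentiableAt_complex_iff_differentiableAt_real.2 ⟨d'.differentiableAt, ?_⟩
  rw [d'.fderiv]
  have e1 : fderiv ℝ (mollify φ h) x 1 = -fderiv ℝ (mollify φ g) x Complex.I := by linarith
  have e2 : fderiv ℝ (mollify φ h) x Complex.I = fderiv ℝ (mollify φ g) x 1 := by linarith
  refine Complex.ext ?_ ?_ <;> simp [e1, e2]

theorem integral_normed_sub (x : ℂ) : ∫ y, φ.normed volume (x - y) = 1 := by
  rw [integral_sub_left_eq_self (φ.normed volume) volume x, φ.integral_normed]

/-- Jensen's inequality, obtained as nonnegativity of the variance of `f` under the probability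
density `y ↦ φ (x - y)`. -/
theorem mollify_sq_le (hf : LocallyIntegrable f) (hf2 : LocallyIntegrable fun y => f y ^ 2) (x : ℂ) :
    mollify φ f x ^ 2 ≤ mollify φ (fun y => f y ^ 2) x := by
  have i0 : Integrable fun y => φ.normed volume (x - y) := φ.integrable_normed.comp_sub_left x
  have i1 := integrable_normed_sub_mul φ hf x
  have i2 := integrable_normed_sub_mul φ hf2 x
  set m := mollify φ f x with hm
  have hpos : 0 ≤ ∫ y, φ.normed volume (x - y) * (f y - m) ^ 2 :=
    integral_nonneg fun y => mul_nonneg (φ.nonneg_normed _) (sq_nonneg _)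
  have e : ∀ y, φ.normed volume (x - y) * (f y - m) ^ 2 =
      φ.normed volume (x - y) * f y ^ 2 - 2 * m * (φ.normed volume (x - y) * f y) +
        m ^ 2 * φ.normed volume (x - y) := fun y => by ring
  simp_rw [e] at hpos
  have i12 : Integrable fun y => φ.normed volume (x - y) * f y ^ 2 -
      2 * m * (φ.normed volume (x - y) * f y) := i2.sub (i1.const_mul _)
  rw [integral_add i12 (i0.const_mul _), integral_sub i2 (i1.const_mul _),
    integral_const_mul, integral_const_mul, integral_normed_sub, ← mollify_apply, ← mollify_apply,
    ← hm] at hpos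
  linarith

theorem setIntegral_mollify_sq_le (hf : Integrable f) (hf2 : Integrable fun y => f y ^ 2)
    (D : Set ℂ) : ∫ x in D, mollify φ f x ^ 2 ≤ ∫ x, f x ^ 2 := by
  have hi : Integrable (mollify φ fun y => f y ^ 2) :=
    Integrable.integrable_convolution _ φ.integrable_normed hf2
  have hle := mollify_sq_le φ hf.locallyIntegrable hf2.locallyIntegrable
  calc ∫ x in D, mollify φ f x ^ 2 ≤ ∫ x in D, mollify φ (fun y => f y ^ 2) x :=
        integral_mono_of_nonneg (Filter.Eventually.of_forall fun x => sq_nonneg _) hi.integrableOn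
          (Filter.Eventually.of_forall hle)
    _ ≤ ∫ x, mollify φ (fun y => f y ^ 2) x :=
        setIntegral_le_integral hi (Filter.Eventually.of_forall fun x => (sq_nonneg _).trans (hle x))
    _ = ∫ x, f x ^ 2 := by
        rw [mollify, integral_convolution _ φ.integrable_normed hf2, φ.integral_normed]
        simp

end Mollification

/-! ### Variance as a double integral -/

section Variance

variable {X : Type*} [MeasurableSpace X] {μ : Measure X} [IsFiniteMeasure μ] {f : X → ℝ}

theorem integrable_sub_sq_prod (hf : Integrable f μ) (hf2 : Integrable (fun x => f x ^ 2) μ) :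
    Integrable (fun p : X × X => (f p.1 - f p.2) ^ 2) (μ.prod μ) := by
  have := ((hf2.comp_fst μ).add (hf2.comp_snd μ)).sub ((hf.mul_prod hf).const_mul 2)
  refine this.congr (Filter.Eventually.of_forall fun p => ?_)
  simp only [Pi.add_apply, Pi.sub_apply]
  ring

theorem integral_sub_sq_prod (hf : Integrable f μ) (hf2 : Integrable (fun x => f x ^ 2) μ) :
    ∫ p : X × X, (f p.1 - f p.2) ^ 2 ∂μ.prod μ =
      2 * (μ.real Set.univ * ∫ x, f x ^ 2 ∂μ) - 2 * (∫ x, f x ∂μ) ^ 2 := by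
  have e : ∀ p : X × X, (f p.1 - f p.2) ^ 2 = f p.1 ^ 2 + f p.2 ^ 2 - 2 * (f p.1 * f p.2) :=
    fun p => by ring
  simp_rw [e]
  have i12 : Integrable (fun p : X × X => f p.1 ^ 2 + f p.2 ^ 2) (μ.prod μ) :=
    (hf2.comp_fst μ).add (hf2.comp_snd μ)
  rw [integral_sub i12 ((hf.mul_prod hf).const_mul 2),
    integral_add (hf2.comp_fst μ) (hf2.comp_snd μ), integral_const_mul, integral_prod_mul,
    integral_fun_fst fun x => f x ^ 2, integral_fun_snd fun x => f x ^ 2]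
  simp only [smul_eq_mul]
  ring

/-- The double integral is unchanged when a constant is subtracted from `f`. This is what later
removes the value at the centre from the estimate. -/
theorem integral_sub_sq_prod_le (hf : Integrable f μ) (hf2 : Integrable (fun x => f x ^ 2) μ)
    (c : ℝ) : ∫ p : X × X, (f p.1 - f p.2) ^ 2 ∂μ.prod μ ≤
      2 * (μ.real Set.univ * ∫ x, (f x - c) ^ 2 ∂μ) := by
  have h1 : Integrable (fun x => f x - c) μ := hf.sub (integrable_const c)
  have h2 : Integrable (fun x => (f x - c) ^ 2) μ := by
    refine ((hf2.sub (hf.const_mul (2 * c))).add (integrable_const (c ^ 2))).congr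
      (Filter.Eventually.of_forall fun x => ?_)
    simp only [Pi.add_apply, Pi.sub_apply]
    ring
  have := integral_sub_sq_prod h1 h2
  simp only [sub_sub_sub_cancel_right] at this
  rw [this]
  linarith [sq_nonneg (∫ x, (f x - c) ∂μ)]

end Variance

/-! ### The Friedrichs inequality for weak solutions -/

section WeakFriedrichs

variable {S : Set ℂ} {ρ R u : ℝ} {h g : ℂ → ℝ}

/-- A ball of radius `ρ κ / 4` changes the gauge by at most `κ / 4`, so mollification stays inside
`S` on the open set `gauge < 1 - κ / 2`, which contains `gauge ≤ 1 - κ`. The holomorphic inequality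
applies there after the real part at `0` is subtracted. -/
theorem friedrichs_mollify (hρ : 0 < ρ) (hu0 : 0 ≤ u) (hu1 : u < 1)
    (hρR : ρ ^ 2 = R ^ 2 * (1 - u ^ 2)) (hS : IsOpen S) (hb : Metric.ball 0 ρ ⊆ S)
    (hs : ∀ y ∈ Metric.ball (0 : ℂ) ρ, ∀ x ∈ S, segment ℝ y x ⊆ S) (hSR : S ⊆ Metric.closedBall 0 R)
    (hh : Integrable h) (hg : Integrable g) (hg2 : Integrable fun z => g z ^ 2)
    (H : IsWeaklyHolomorphicOn S h g) {κ : ℝ} (hκ0 : 0 < κ) (hκ1 : κ < 1)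
    (φ : ContDiffBump (0 : ℂ)) (hφ : φ.rOut ≤ ρ * κ / 4) :
    (1 - u) * ∫ z in {z | gauge S z < 1 - κ}, (mollify φ h z - mollify φ h 0) ^ 2 ≤
      (1 + u) * ∫ z, g z ^ 2 := by
  have h0ball : (0 : ℂ) ∈ Metric.ball (0 : ℂ) ρ := Metric.mem_ball_self hρ
  have h0S : (0 : ℂ) ∈ S := hb h0ball
  have hlip := lipschitzWith_gauge_of_segment_subset hρ hb hs
  have hR0 : 0 ≤ R := by simpa using hSR h0S
  have hR : 0 < R := by
    refine hR0.lt_of_ne fun h => ?_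
    rw [← h] at hρR
    nlinarith
  have habs : Absorbent ℝ S := absorbent_nhds_zero (hS.mem_nhds h0S)
  have hNR : ∀ z, ‖z‖ ≤ R * gauge S z := fun z => by
    have := le_gauge_of_subset_closedBall habs hR0 hSR (x := z)
    rwa [div_le_iff₀' hR] at this
  have hball : ∀ z, gauge S z < 1 - κ / 2 → Metric.closedBall z φ.rOut ⊆ S := fun z hz w hw => by
    rw [← gauge_lt_one_iff_mem_of_isOpen hS h0S (hs 0 h0ball)]
    have h1 := gauge_add_le_of_segment_subset hρ hb hs z (w - z)
    rw [add_sub_cancel] at h1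
    have h2 : ‖w - z‖ / ρ ≤ κ / 4 := by
      rw [div_le_iff₀ hρ, ← dist_eq_norm]
      exact (Metric.mem_closedBall.1 hw).trans (by linarith)
    linarith
  set F : ℂ → ℂ := fun z => ((mollify φ h z : ℂ) - mollify φ g z * Complex.I) - (mollify φ h 0 : ℂ)
    with hF
  have key := friedrichs_holomorphic (N := gauge S) (t := 1 - κ) (F := F)
    (U := {z | gauge S z < 1 - κ / 2}) hρ hu0 hu1.le hρR hlip gauge_nonneg
    (fun c hc z => by rw [gauge_smul_of_nonneg hc, smul_eq_mul]) hNR (by linarith)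
    (isOpen_lt hlip.continuous continuous_const)
    (fun z (hz : gauge S z ≤ 1 - κ) => show gauge S z < 1 - κ / 2 by linarith)
    (fun z hz => ((H.differentiableAt φ hh.locallyIntegrable hg.locallyIntegrable
      (hball z hz)).sub_const _).differentiableWithinAt)
    (by simp [hF])
  have e1 : ∀ z, (F z).re = mollify φ h z - mollify φ h 0 := fun z => by simp [hF]
  have e2 : ∀ z, (F z).im ^ 2 = mollify φ g z ^ 2 := fun z => by simp [hF]
  simp_rw [e1, e2] at key
  exact key.trans (mul_le_mul_of_nonneg_left (setIntegral_mollify_sq_le φ hg hg2 _) (by linarith))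

/-- The Friedrichs inequality for conjugate harmonic functions on a star-shaped domain. -/
theorem friedrichs_of_isWeaklyHolomorphicOn (hρ : 0 < ρ) (hu0 : 0 ≤ u) (hu1 : u < 1)
    (hρR : ρ ^ 2 = R ^ 2 * (1 - u ^ 2)) (hS : IsOpen S) (hb : Metric.ball 0 ρ ⊆ S)
    (hs : ∀ y ∈ Metric.ball (0 : ℂ) ρ, ∀ x ∈ S, segment ℝ y x ⊆ S) (hSR : S ⊆ Metric.closedBall 0 R)
    (hh : Integrable h) (hh2 : Integrable fun z => h z ^ 2) (hg : Integrable g)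
    (hg2 : Integrable fun z => g z ^ 2) (H : IsWeaklyHolomorphicOn S h g)
    (hmean : ∫ z in S, h z = 0) :
    (1 - u) * ∫ z in S, h z ^ 2 ≤ (1 + u) * ∫ z, g z ^ 2 := by
  have h0ball : (0 : ℂ) ∈ Metric.ball (0 : ℂ) ρ := Metric.mem_ball_self hρ
  have h0S : (0 : ℂ) ∈ S := hb h0ball
  have hlip := lipschitzWith_gauge_of_segment_subset hρ hb hs
  set μ : Measure ℂ := volume.restrict S with hμ
  have hSfin : volume S < ⊤ := (measure_mono hSR).trans_lt measure_closedBall_lt_top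
  have : IsFiniteMeasure μ := ⟨by rwa [hμ, Measure.restrict_apply_univ]⟩
  have hμS : μ.real Set.univ = volume.real S := by simp [hμ, measureReal_def]
  have hSpos : 0 < volume.real S :=
    ENNReal.toReal_pos (hS.measure_pos volume ⟨0, h0S⟩).ne' hSfin.ne
  -- The shift by `2` keeps `κ n < 1` already for `n = 0`.
  set κ : ℕ → ℝ := fun n => 1 / ((n : ℝ) + 2) with hκ
  have hκ0 : ∀ n, 0 < κ n := fun n => by positivity
  have hκ1 : ∀ n, κ n < 1 := fun n => by
    simp only [hκ]
    rw [div_lt_one (by positivity)]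
    linarith [n.cast_nonneg (α := ℝ)]
  have hκlim : Filter.Tendsto κ Filter.atTop (nhds 0) :=
    (tendsto_const_nhds (x := (1 : ℝ))).div_atTop
      (Filter.tendsto_atTop_add_const_right _ 2 tendsto_natCast_atTop_atTop)
  set φ : ℕ → ContDiffBump (0 : ℂ) := fun n =>
    { rIn := ρ * κ n / 8
      rOut := ρ * κ n / 4
      rIn_pos := by have := hκ0 n; positivity
      rIn_lt_rOut := by have := mul_pos hρ (hκ0 n); linarith } with hφ
  set D : ℕ → Set ℂ := fun n => {z | gauge S z < 1 - κ n} with hD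
  have hDmeas : ∀ n, MeasurableSet (D n) := fun n =>
    measurableSet_lt hlip.continuous.measurable measurable_const
  have hDS : ∀ n, D n ⊆ S := fun n z (hz : gauge S z < 1 - κ n) => by
    rw [← gauge_lt_one_iff_mem_of_isOpen hS h0S (hs 0 h0ball)]
    linarith [hκ0 n]
  set f : ℕ → ℂ → ℝ := fun n => mollify (φ n) h with hf
  have hfc : ∀ n, Continuous (f n) := fun n =>
    (contDiff_mollify (φ n) hh.locallyIntegrable).continuous
  have hlim : ∀ᵐ z, Filter.Tendsto (fun n => f n z) Filter.atTop (nhds (h z)) := by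
    -- `K = 2` is the ratio of the outer to the inner radius of the bumps.
    refine ContDiffBump.ae_convolution_tendsto_right_of_locallyIntegrable (K := 2) (φ := φ) ?_ ?_
      hh.locallyIntegrable
    · have := (hκlim.const_mul ρ).div_const 4
      simpa using this
    · refine Filter.Eventually.of_forall fun n => ?_
      simp only [hφ]
      linarith
  set C : ℝ := 2 * (volume.real S * ((1 + u) / (1 - u) * ∫ z, g z ^ 2)) with hC
  set w : ℕ → ℂ × ℂ → ENNReal := fun n =>
    (D n ×ˢ D n).indicator fun p => ENNReal.ofReal ((f n p.1 - f n p.2) ^ 2) with hw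
  have hwmeas : ∀ n, Measurable (w n) := fun n =>
    (by have := hfc n; fun_prop : Measurable fun p : ℂ × ℂ =>
      ENNReal.ofReal ((f n p.1 - f n p.2) ^ 2)).indicator ((hDmeas n).prod (hDmeas n))
  have hbound : ∀ n, ∫⁻ p, w n p ∂μ.prod μ ≤ ENNReal.ofReal C := fun n => by
    have hKD : D n ⊆ Metric.closedBall 0 R := (hDS n).trans hSR
    have hi1 : Integrable (f n) (volume.restrict (D n)) :=
      ((hfc n).continuousOn.integrableOn_compact (isCompact_closedBall _ _)).mono_set hKD
    have hi2 : Integrable (fun z => f n z ^ 2) (volume.restrict (D n)) :=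
      (((hfc n).pow 2).continuousOn.integrableOn_compact (isCompact_closedBall _ _)).mono_set hKD
    have hDfin : volume (D n) < ⊤ := (measure_mono (hDS n)).trans_lt hSfin
    have : IsFiniteMeasure (volume.restrict (D n)) := ⟨by rwa [Measure.restrict_apply_univ]⟩
    rw [hw, lintegral_indicator ((hDmeas n).prod (hDmeas n)), ← Measure.prod_restrict, hμ,
      Measure.restrict_restrict (hDmeas n), Set.inter_eq_left.2 (hDS n),
      ← ofReal_integral_eq_lintegral_ofReal (integrable_sub_sq_prod hi1 hi2)
        (Filter.Eventually.of_forall fun p => sq_nonneg _)]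
    refine ENNReal.ofReal_le_ofReal ((integral_sub_sq_prod_le hi1 hi2 (f n 0)).trans ?_)
    have h1 := friedrichs_mollify hρ hu0 hu1 hρR hS hb hs hSR hh hg hg2 H (hκ0 n) (hκ1 n) (φ n)
      le_rfl
    have h2 : ∫ z in D n, (f n z - f n 0) ^ 2 ≤ (1 + u) / (1 - u) * ∫ z, g z ^ 2 := by
      rw [div_mul_eq_mul_div, le_div_iff₀' (by linarith)]
      exact h1
    have h3 : (volume.restrict (D n)).real Set.univ ≤ volume.real S := by
      rw [measureReal_restrict_apply MeasurableSet.univ, Set.univ_inter]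
      exact measureReal_mono (hDS n) hSfin.ne
    rw [hC]
    refine mul_le_mul_of_nonneg_left (mul_le_mul h3 h2 ?_ hSpos.le) zero_le_two
    exact integral_nonneg fun z => sq_nonneg _
  have hlimS : ∀ᵐ z ∂μ, (∀ᶠ n in Filter.atTop, z ∈ D n) ∧
      Filter.Tendsto (fun n => f n z) Filter.atTop (nhds (h z)) := by
    filter_upwards [ae_restrict_mem hS.measurableSet, ae_restrict_of_ae hlim] with z hz hz'
    refine ⟨?_, hz'⟩
    have h1 : gauge S z < 1 - 0 := by simpa using gauge_lt_one_of_mem_of_isOpen hS hz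
    exact (tendsto_const_nhds.sub hκlim).eventually (lt_mem_nhds h1)
  have hliminf : ∀ᵐ p ∂μ.prod μ, ENNReal.ofReal ((h p.1 - h p.2) ^ 2) =
      Filter.liminf (fun n => w n p) Filter.atTop := by
    filter_upwards [Measure.quasiMeasurePreserving_fst.ae hlimS,
      Measure.quasiMeasurePreserving_snd.ae hlimS] with p h1 h2
    refine (Filter.Tendsto.liminf_eq ?_).symm
    have ht : Filter.Tendsto (fun n => ENNReal.ofReal ((f n p.1 - f n p.2) ^ 2)) Filter.atTop
        (nhds (ENNReal.ofReal ((h p.1 - h p.2) ^ 2))) :=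
      (ENNReal.continuous_ofReal.tendsto _).comp ((h1.2.sub h2.2).pow 2)
    refine ht.congr' ?_
    filter_upwards [h1.1, h2.1] with n m1 m2
    simp only [hw]
    rw [Set.indicator_of_mem (Set.mk_mem_prod m1 m2)]
  -- Fatou's lemma on `S × S` needs only almost everywhere convergence and the uniform bound. No
  -- limit of `f n 0` is required.
  have hfatou : ∫⁻ p, ENNReal.ofReal ((h p.1 - h p.2) ^ 2) ∂μ.prod μ ≤ ENNReal.ofReal C := by
    rw [lintegral_congr_ae hliminf]
    refine (lintegral_liminf_le hwmeas).trans ?_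
    exact (Filter.liminf_le_liminf (Filter.Eventually.of_forall hbound)).trans
      (Filter.liminf_const _).le
  have hi1 : Integrable h μ := hh.integrableOn
  have hi2 : Integrable (fun z => h z ^ 2) μ := hh2.integrableOn
  have hCpos : 0 ≤ C := by
    have : 0 ≤ ∫ z, g z ^ 2 := integral_nonneg fun z => sq_nonneg _
    have : 0 < 1 - u := by linarith
    positivity
  rw [← ofReal_integral_eq_lintegral_ofReal (integrable_sub_sq_prod hi1 hi2)
    (Filter.Eventually.of_forall fun p => sq_nonneg _), ENNReal.ofReal_le_ofReal_iff hCpos,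
    integral_sub_sq_prod hi1 hi2, hmean, hC, hμS] at hfatou
  have hfin : ∫ z in S, h z ^ 2 ≤ (1 + u) / (1 - u) * ∫ z, g z ^ 2 := by
    refine le_of_mul_le_mul_left ?_ hSpos
    linarith
  rw [div_mul_eq_mul_div, le_div_iff₀' (by linarith)] at hfin
  exact hfin

end WeakFriedrichs

/-! ### From Friedrichs to inf-sup in Hilbert space -/

section InfSup

open scoped RealInnerProductSpace

variable {E L : Type*} [NormedAddCommGroup E] [InnerProductSpace ℝ E]
  [NormedAddCommGroup L] [InnerProductSpace ℝ L]

theorem inner_topologicalClosure_eq {A : Submodule ℝ E} {d c : E →L[ℝ] L}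
    (hA : ∀ w ∈ A, ∀ w' ∈ A, ⟪w, w'⟫ = ⟪d w, d w'⟫ + ⟪c w, c w'⟫) {w w' : E}
    (hw : w ∈ A.topologicalClosure) (hw' : w' ∈ A.topologicalClosure) :
    ⟪w, w'⟫ = ⟪d w, d w'⟫ + ⟪c w, c w'⟫ := by
  have h1 : ∀ w ∈ A, ∀ w' ∈ closure (A : Set E), ⟪w, w'⟫ = ⟪d w, d w'⟫ + ⟪c w, c w'⟫ := by
    intro w hw w' hw'
    exact closure_minimal (s := (A : Set E)) (t := {w' | ⟪w, w'⟫ = ⟪d w, d w'⟫ + ⟪c w, c w'⟫})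
      (fun w' hw' => hA w hw w' hw') (isClosed_eq (by fun_prop) (by fun_prop)) hw'
  exact closure_minimal (s := (A : Set E)) (t := {w | ⟪w, w'⟫ = ⟪d w, d w'⟫ + ⟪c w, c w'⟫})
    (fun w hw => h1 w hw w' hw') (isClosed_eq (by fun_prop) (by fun_prop)) hw

/-- The Friedrichs inequality, with constant `(1 + u) / (1 - u)`, implies the inf-sup condition
with constant `√((1 - u) / 2)`. Here `d` and `c` stand for the divergence and the curl. -/
theorem exists_infSup_of_friedrichs [CompleteSpace E] [CompleteSpace L] {A : Submodule ℝ E} {d c : E →L[ℝ] L} {one q : L} {u : ℝ}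
    (hA : ∀ w ∈ A, ∀ w' ∈ A, ⟪w, w'⟫ = ⟪d w, d w'⟫ + ⟪c w, c w'⟫)
    (hone : ∀ w ∈ A, ⟪one, d w⟫ = 0) (hq1 : ⟪one, q⟫ = 0) (hq : q ≠ 0) (hu0 : 0 ≤ u) (hu1 : u < 1)
    (hF : ∀ h g : L, ⟪one, h⟫ = 0 → (∀ w ∈ A, ⟪h, d w⟫ = ⟪g, c w⟫) →
      (1 - u) * ‖h‖ ^ 2 ≤ (1 + u) * ‖g‖ ^ 2) {b : ℝ} (hb : b < √((1 - u) / 2)) :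
    ∃ w ∈ A, w ≠ 0 ∧ b ≤ ⟪d w, q⟫ / (‖w‖ * ‖q‖) := by
  set K := A.topologicalClosure with hK
  have : CompleteSpace K := A.isClosed_topologicalClosure.completeSpace_coe
  -- The Riesz representative in `K` of the functional `w ↦ ⟪q, d w⟫`.
  set v : E := K.starProjection (ContinuousLinearMap.adjoint d q) with hv
  have hvK : v ∈ K := Submodule.starProjection_apply_mem _ _
  have hvw : ∀ w ∈ K, ⟪v, w⟫ = ⟪q, d w⟫ := fun w hw => by
    have h1 : ⟪ContinuousLinearMap.adjoint d q - v, w⟫ = 0 :=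
      Submodule.starProjection_inner_eq_zero _ w hw
    rw [inner_sub_left, ContinuousLinearMap.adjoint_inner_left] at h1
    linarith
  have hAK : ∀ w ∈ A, w ∈ K := fun w hw => A.le_topologicalClosure hw
  set p := d v with hp
  set g := c v with hg
  have hp1 : ⟪one, p⟫ = 0 :=
    closure_minimal (s := (A : Set E)) (t := {w | ⟪one, d w⟫ = 0}) hone
      (isClosed_eq (by fun_prop) (by fun_prop)) hvK
  -- Comparing `⟪v, w⟫ = ⟪q, d w⟫` with `⟪v, w⟫ = ⟪p, d w⟫ + ⟪g, c w⟫` gives the weak Cauchy-Riemann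
  -- equations for `q - p` and `g`.
  have hfr := hF (q - p) g (by rw [inner_sub_right, hq1, hp1, sub_zero]) fun w hw => by
    have h1 := inner_topologicalClosure_eq hA hvK (hAK w hw)
    rw [hvw w (hAK w hw)] at h1
    rw [inner_sub_left]
    linarith
  have hvv : ‖v‖ ^ 2 = ‖p‖ ^ 2 + ‖g‖ ^ 2 := by
    have h1 := inner_topologicalClosure_eq hA hvK hvK
    simpa [real_inner_self_eq_norm_sq] using h1
  have hqp : ⟪p, q⟫ = ‖v‖ ^ 2 := by
    rw [← real_inner_self_eq_norm_sq, hvw v hvK, real_inner_comm]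
  have hph : ⟪p, q - p⟫ = ‖g‖ ^ 2 := by
    rw [inner_sub_right, hqp, real_inner_self_eq_norm_sq, hvv]; ring
  have hcs : (‖g‖ ^ 2) ^ 2 ≤ ‖p‖ ^ 2 * ‖q - p‖ ^ 2 := by
    rw [← hph, ← mul_pow]
    exact sq_le_sq' (by linarith [neg_le_of_abs_le (abs_real_inner_le_norm p (q - p))])
      (real_inner_le_norm _ _)
  have hqq : ‖q‖ ^ 2 = ‖p‖ ^ 2 + 2 * ‖g‖ ^ 2 + ‖q - p‖ ^ 2 := by
    rw [← hph, ← norm_add_sq_real, add_sub_cancel]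
  have hmain : (1 - u) / 2 * ‖q‖ ^ 2 ≤ ‖v‖ ^ 2 := by
    -- Multiply Friedrichs by `‖p‖²`, combine with `‖g‖⁴ ≤ ‖p‖² ‖q - p‖²`, and cancel `‖g‖²`; hence
    -- the separate case `g = 0`.
    have hpg : (1 - u) * ‖g‖ ^ 2 ≤ (1 + u) * ‖p‖ ^ 2 := by
      rcases (sq_nonneg ‖g‖).eq_or_lt with h | h
      · rw [← h]; nlinarith [sq_nonneg ‖p‖]
      · refine le_of_mul_le_mul_left ?_ h
        nlinarith [mul_le_mul_of_nonneg_left hcs (sub_nonneg.2 hu1.le),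
          mul_le_mul_of_nonneg_left hfr (sq_nonneg ‖p‖)]
    rw [hqq, hvv]
    nlinarith
  have hqpos : 0 < ‖q‖ := norm_pos_iff.2 hq
  have hratio : √((1 - u) / 2) * ‖q‖ ≤ ‖v‖ := by
    refine abs_le_of_sq_le_sq' ?_ (norm_nonneg v) |>.2
    rw [mul_pow, Real.sq_sqrt (by linarith)]
    exact hmain
  have hvpos : 0 < ‖v‖ :=
    (mul_pos (Real.sqrt_pos.2 (by linarith)) hqpos).trans_le hratio
  have hval : b < ⟪d v, q⟫ / (‖v‖ * ‖q‖) := by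
    rw [← hp, hqp, pow_two, mul_div_mul_left _ _ hvpos.ne']
    exact hb.trans_le ((le_div_iff₀ hqpos).2 hratio)
  -- The maximiser `v` is only in the closure of `A`. The strict inequality in `hval` survives at a
  -- nearby element of `A`.
  have hcont : ContinuousAt (fun w => ⟪d w, q⟫ / (‖w‖ * ‖q‖)) v :=
    ContinuousAt.div (by fun_prop) (by fun_prop) (mul_pos hvpos hqpos).ne'
  have hev : ∀ᶠ w in nhds v, w ≠ 0 ∧ b ≤ ⟪d w, q⟫ / (‖w‖ * ‖q‖) :=
    (continuousAt_id.eventually_ne (norm_pos_iff.1 hvpos)).and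
      ((hcont.eventually (lt_mem_nhds hval)).mono fun w hw => hw.le)
  obtain ⟨w, hw, hwA⟩ := mem_closure_iff_nhds.1 hvK _ hev
  exact ⟨w, hwA, hw⟩

end InfSup

/-! ### Gradients of test fields -/

section TestFields

open scoped RealInnerProductSpace

variable {Ω : Opens Plane}

/-- The partial derivative of a test function, as a test function. -/
noncomputable def testDeriv (i : Fin 2) : 𝓓(Ω, ℝ) →ₗ[ℝ] 𝓓(Ω, ℝ) :=
  (TestFunction.lineDerivCLM ℝ (EuclideanSpace.single i (1 : ℝ)) : 𝓓(Ω, ℝ) →L[ℝ] 𝓓(Ω, ℝ))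

theorem testDeriv_apply (i : Fin 2) (φ : 𝓓(Ω, ℝ)) (x : Plane) :
    testDeriv i φ x = partialDeriv i φ x := by
  change (TestFunction.lineDerivCLM ℝ (EuclideanSpace.single i (1 : ℝ)) φ : 𝓓(Ω, ℝ)) x = _
  rw [TestFunction.lineDerivCLM_eq_fderivCLM, TestFunction.fderivCLM_apply_of_le _ (by simp)]
  rfl

theorem memLp_testFunction (φ : 𝓓(Ω, ℝ)) : MemLp φ 2 (domainMeasure Ω) :=
  (φ.continuous.memLp_of_hasCompactSupport (μ := volume) φ.hasCompactSupport).restrict _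

/-- The inclusion of the test functions in `L²(Ω)`. -/
noncomputable def testToL2 : 𝓓(Ω, ℝ) →ₗ[ℝ] L2 Ω where
  toFun φ := (memLp_testFunction φ).toLp φ
  map_add' _ _ := rfl
  map_smul' _ _ := rfl

theorem coeFn_testToL2 (φ : 𝓓(Ω, ℝ)) : testToL2 φ =ᵐ[domainMeasure Ω] φ :=
  (memLp_testFunction φ).coeFn_toLp

theorem testFunction_eq_zero_of_notMem (φ : 𝓓(Ω, ℝ)) {x : Plane} (hx : x ∉ (Ω : Set Plane)) :
    φ x = 0 :=
  image_eq_zero_of_notMem_tsupport fun h => hx (φ.tsupport_subset h)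

theorem setIntegral_mul_testFunction (f : Plane → ℝ) (φ : 𝓓(Ω, ℝ)) :
    ∫ x in Ω, f x * φ x = ∫ x, f x * φ x :=
  setIntegral_eq_integral_of_forall_compl_eq_zero fun x hx => by
    rw [testFunction_eq_zero_of_notMem φ hx, mul_zero]

theorem integral_mul_partialDeriv (i : Fin 2) (φ ψ : 𝓓(Ω, ℝ)) :
    ∫ x in Ω, φ x * partialDeriv i ψ x = -∫ x in Ω, partialDeriv i φ x * ψ x := by
  have h1 := setIntegral_mul_testFunction φ (testDeriv i ψ)
  simp only [testDeriv_apply] at h1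
  rw [h1, setIntegral_mul_testFunction]
  refine integral_mul_fderiv_eq_neg_fderiv_mul_of_integrable ?_ ?_ ?_
    (fun x _ => φ.contDiff.differentiable (by simp) x)
    (fun x _ => ψ.contDiff.differentiable (by simp) x)
  · exact ((continuous_partialDeriv i φ).mul ψ.continuous).integrable_of_hasCompactSupport
      ψ.hasCompactSupport.mul_left
  · exact (φ.continuous.mul (continuous_partialDeriv i ψ)).integrable_of_hasCompactSupport
      φ.hasCompactSupport.mul_right
  · exact (φ.continuous.mul ψ.continuous).integrable_of_hasCompactSupport
      φ.hasCompactSupport.mul_right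

theorem inner_testToL2 (f : L2 Ω) (φ : 𝓓(Ω, ℝ)) : ⟪f, testToL2 φ⟫ = ∫ x in Ω, f x * φ x := by
  rw [L2.inner_def]
  refine integral_congr_ae ?_
  filter_upwards [coeFn_testToL2 φ] with x hx
  rw [hx]
  simp [mul_comm]

theorem inner_testToL2_testToL2 (φ ψ : 𝓓(Ω, ℝ)) :
    ⟪testToL2 φ, testToL2 ψ⟫ = ∫ x in Ω, φ x * ψ x := by
  rw [inner_testToL2]
  refine integral_congr_ae ?_
  filter_upwards [coeFn_testToL2 φ] with x hx
  rw [hx]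

theorem partialDeriv_comm (i j : Fin 2) (φ : 𝓓(Ω, ℝ)) (x : Plane) :
    partialDeriv i (partialDeriv j φ) x = partialDeriv j (partialDeriv i φ) x := by
  have two_le : (2 : WithTop ℕ∞) ≤ ∞ := ENat.LEInfty.out
  have hsymm : IsSymmSndFDerivAt ℝ φ x :=
    (φ.contDiff.contDiffAt (x := x)).isSymmSndFDerivAt (by simpa using two_le)
  have hd : DifferentiableAt ℝ (fderiv ℝ φ) x :=
    (φ.contDiff.fderiv_right (m := 1) (by simpa [one_add_one_eq_two] using two_le)).differentiable one_ne_zero x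
  have e : ∀ k l, partialDeriv k (partialDeriv l φ) x =
      fderiv ℝ (fderiv ℝ φ) x (EuclideanSpace.single k 1) (EuclideanSpace.single l 1) := fun k l => by
    have := (hd.hasFDerivAt.clm_apply
      (hasFDerivAt_const (EuclideanSpace.single l (1 : ℝ)) x)).fderiv
    unfold partialDeriv
    rw [this]
    simp
  rw [e, e]
  exact hsymm.eq _ _

/-- Integration by parts moves the derivative off `φ`, and the second derivatives of `ψ` commute. -/
theorem inner_testDeriv_comm (i j : Fin 2) (φ ψ : 𝓓(Ω, ℝ)) :
    ⟪testToL2 (testDeriv i φ), testToL2 (testDeriv j ψ)⟫ =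
      ⟪testToL2 (testDeriv j φ), testToL2 (testDeriv i ψ)⟫ := by
  have key : ∀ k l, ⟪testToL2 (testDeriv k φ), testToL2 (testDeriv l ψ)⟫ =
      -∫ x in Ω, φ x * partialDeriv k (partialDeriv l ψ) x := fun k l => by
    have h := integral_mul_partialDeriv k φ (testDeriv l ψ)
    have e : (testDeriv l ψ : Plane → ℝ) = partialDeriv l ψ := funext (testDeriv_apply l ψ)
    rw [e] at h
    rw [h, neg_neg, inner_testToL2_testToL2]
    simp only [testDeriv_apply]
  rw [key, key]
  simp_rw [partialDeriv_comm i j]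

/-- A test function, as an element of `H¹₀(Ω)`. -/
noncomputable def testToH10 (φ : 𝓓(Ω, ℝ)) : H10 Ω :=
  ⟨⟨WithLp.toLp 2 (testToL2 φ, WithLp.toLp 2 fun i => testToL2 (testDeriv i φ)), fun i ψ => by
    change ∫ x in Ω, testToL2 φ x * partialDeriv i ψ x =
      -∫ x in Ω, testToL2 (testDeriv i φ) x * ψ x
    have h1 : ∫ x in Ω, testToL2 φ x * partialDeriv i ψ x = ∫ x in Ω, φ x * partialDeriv i ψ x := by
      refine integral_congr_ae ?_
      filter_upwards [coeFn_testToL2 φ] with x hx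
      rw [hx]
    have h2 : ∫ x in Ω, testToL2 (testDeriv i φ) x * ψ x = ∫ x in Ω, partialDeriv i φ x * ψ x := by
      refine integral_congr_ae ?_
      filter_upwards [coeFn_testToL2 (testDeriv i φ)] with x hx
      rw [hx, testDeriv_apply]
    rw [h1, h2, integral_mul_partialDeriv]⟩,
  subset_closure ⟨φ, coeFn_testToL2 φ, fun i => by
    filter_upwards [coeFn_testToL2 (testDeriv i φ)] with x hx
    rw [← testDeriv_apply]
    exact hx⟩⟩

/-- The space `L²(Ω)^{2 × 2}` of matrix fields. -/
abbrev L2Matrix (Ω : Opens Plane) : Type := PiLp 2 fun _ : Fin 2 × Fin 2 => L2 Ω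

/-- The Jacobian matrix of a vector field whose components are test functions. -/
noncomputable def testGrad : (Fin 2 → 𝓓(Ω, ℝ)) →ₗ[ℝ] L2Matrix Ω :=
  (WithLp.linearEquiv 2 ℝ (Fin 2 × Fin 2 → L2 Ω)).symm.toLinearMap ∘ₗ
    LinearMap.pi fun p => testToL2 ∘ₗ testDeriv p.2 ∘ₗ LinearMap.proj p.1

theorem testGrad_apply (φ : Fin 2 → 𝓓(Ω, ℝ)) (p : Fin 2 × Fin 2) :
    testGrad φ p = testToL2 (testDeriv p.2 (φ p.1)) := rfl

/-- The trace of a matrix field, the divergence if it is a Jacobian matrix. -/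
noncomputable def matrixDiv : L2Matrix Ω →L[ℝ] L2 Ω :=
  PiLp.proj (𝕜 := ℝ) 2 (fun _ : Fin 2 × Fin 2 => L2 Ω) (0, 0) + PiLp.proj (𝕜 := ℝ) 2 (fun _ : Fin 2 × Fin 2 => L2 Ω) (1, 1)

/-- The scalar curl of a vector field in terms of its Jacobian matrix. -/
noncomputable def matrixCurl : L2Matrix Ω →L[ℝ] L2 Ω :=
  PiLp.proj (𝕜 := ℝ) 2 (fun _ : Fin 2 × Fin 2 => L2 Ω) (1, 0) - PiLp.proj (𝕜 := ℝ) 2 (fun _ : Fin 2 × Fin 2 => L2 Ω) (0, 1)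

theorem matrixDiv_apply (w : L2Matrix Ω) : matrixDiv w = w (0, 0) + w (1, 1) := rfl

theorem matrixCurl_apply (w : L2Matrix Ω) : matrixCurl w = w (1, 0) - w (0, 1) := rfl

/-- The mixed products on the right are `⟪∂₀φ₀, ∂₁ψ₁⟫ - ⟪∂₁φ₀, ∂₀ψ₁⟫` and its counterpart for `φ₁,
ψ₀`; both vanish by `inner_testDeriv_comm`. -/
theorem inner_testGrad (φ ψ : Fin 2 → 𝓓(Ω, ℝ)) :
    ⟪testGrad φ, testGrad ψ⟫ = ⟪matrixDiv (testGrad φ), matrixDiv (testGrad ψ)⟫ +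
      ⟪matrixCurl (testGrad φ), matrixCurl (testGrad ψ)⟫ := by
  rw [PiLp.inner_apply, Fintype.sum_prod_type]
  simp only [matrixDiv_apply, matrixCurl_apply, testGrad_apply, inner_add_left, inner_add_right,
    inner_sub_left, inner_sub_right, Fin.sum_univ_two]
  linarith [inner_testDeriv_comm 0 1 (φ 0) (ψ 1), inner_testDeriv_comm 1 0 (φ 1) (ψ 0)]

theorem divergence_testToH10 (φ : Fin 2 → 𝓓(Ω, ℝ)) :
    divergence (fun k => testToH10 (φ k)) = matrixDiv (testGrad φ) := by
  rw [divergence, Fin.sum_univ_two]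
  rfl

theorem gradNorm_testToH10 (φ : Fin 2 → 𝓓(Ω, ℝ)) :
    gradNorm (fun k => testToH10 (φ k)) = ‖testGrad φ‖ := by
  rw [gradNorm, PiLp.norm_eq_of_L2, Fintype.sum_prod_type]
  rfl

theorem integral_testDeriv (i : Fin 2) (φ : 𝓓(Ω, ℝ)) : ∫ x in Ω, testDeriv i φ x = 0 := by
  have h1 : ∫ x in Ω, testDeriv i φ x = ∫ x, testDeriv i φ x :=
    setIntegral_eq_integral_of_forall_compl_eq_zero fun x hx =>
      testFunction_eq_zero_of_notMem _ hx
  rw [h1]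
  simp only [testDeriv_apply]
  have i1 : Integrable (partialDeriv i φ) :=
    (continuous_partialDeriv i φ).integrable_of_hasCompactSupport (hasCompactSupport_partialDeriv i φ)
  have i2 : Integrable φ := φ.continuous.integrable_of_hasCompactSupport φ.hasCompactSupport
  have h2 := integral_mul_fderiv_eq_neg_fderiv_mul_of_integrable (μ := volume)
    (f := fun _ : Plane => (1 : ℝ)) (g := φ) (v := EuclideanSpace.single i 1) (by simp)
    (by simp only [one_mul]; exact i1) (by simpa using i2)
    (fun x _ => by fun_prop) (fun x _ => φ.contDiff.differentiable (by simp) x)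
  simp only [one_mul, fderiv_fun_const, Pi.zero_apply, zero_apply, zero_mul, integral_zero,
    neg_zero] at h2
  exact h2

end TestFields

/-! ### Transfer between the plane and `ℂ` -/

section Transfer

open scoped RealInnerProductSpace

/-- The affine isometry from `ℂ` onto the plane that maps `0` to `x₀`. -/
noncomputable def complexToPlane (x₀ : Plane) : ℂ ≃ₜ Plane :=
  Complex.orthonormalBasisOneI.repr.toHomeomorph.trans (Homeomorph.addRight x₀)

variable {x₀ : Plane}

theorem complexToPlane_apply (z : ℂ) :
    complexToPlane x₀ z = Complex.orthonormalBasisOneI.repr z + x₀ := rfl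

theorem complexToPlane_symm_apply (x : Plane) :
    (complexToPlane x₀).symm x = Complex.orthonormalBasisOneI.repr.symm (x - x₀) := by
  rw [Homeomorph.symm_apply_eq, complexToPlane_apply, LinearIsometryEquiv.apply_symm_apply,
    sub_add_cancel]

theorem measurePreserving_complexToPlane : MeasurePreserving (complexToPlane x₀) :=
  (measurePreserving_add_right volume x₀).comp
    Complex.orthonormalBasisOneI.repr.measurePreserving

theorem dist_complexToPlane (z : ℂ) : dist (complexToPlane x₀ z) x₀ = ‖z‖ := by
  rw [complexToPlane_apply, dist_eq_norm, add_sub_cancel_right, LinearIsometryEquiv.norm_map]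

theorem complexToPlane_segment_subset (y z : ℂ) :
    complexToPlane x₀ '' segment ℝ y z ⊆ segment ℝ (complexToPlane x₀ y) (complexToPlane x₀ z) := by
  rintro _ ⟨_, ⟨a, b, ha, hb, hab, rfl⟩, rfl⟩
  refine ⟨a, b, ha, hb, hab, ?_⟩
  simp only [complexToPlane_apply, map_add, map_smul, smul_add]
  have : a • x₀ + b • x₀ = x₀ := by rw [← add_smul, hab, one_smul]
  rw [← add_assoc, add_right_comm (a • _), add_assoc, this]

theorem partialDeriv_comp_complexToPlane_symm {ψ : ℂ → ℝ} (hψ : Differentiable ℝ ψ) (i : Fin 2) (z : ℂ) :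
    partialDeriv i (ψ ∘ (complexToPlane x₀).symm) (complexToPlane x₀ z) =
      fderiv ℝ ψ z (Complex.orthonormalBasisOneI i) := by
  obtain ⟨A, hA⟩ : ∃ A : Plane →L[ℝ] ℂ, ∀ x, A x = Complex.orthonormalBasisOneI.repr.symm x :=
    ⟨Complex.orthonormalBasisOneI.repr.symm.toContinuousLinearEquiv.toContinuousLinearMap,
      fun _ => rfl⟩
  have h1 : HasFDerivAt (complexToPlane x₀).symm A (complexToPlane x₀ z) := by
    have e : ((complexToPlane x₀).symm : Plane → ℂ) = fun x => A x - A x₀ := by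
      funext x
      rw [complexToPlane_symm_apply, ← hA, map_sub]
    rw [e]
    exact A.hasFDerivAt.sub_const _
  have h2 : HasFDerivAt ψ (fderiv ℝ ψ z) ((complexToPlane x₀).symm (complexToPlane x₀ z)) := by
    rw [Homeomorph.symm_apply_apply]
    exact (hψ z).hasFDerivAt
  rw [partialDeriv, (h2.comp _ h1).fderiv, ContinuousLinearMap.comp_apply]
  rw [hA, Complex.orthonormalBasisOneI.repr_symm_single]

variable {Ω : Opens Plane} {ρ R u : ℝ}

/-- The pull-back to `ℂ` of a function on `Ω`, extended by zero. -/
noncomputable def pullback (x₀ : Plane) (Ω : Opens Plane) (f : Plane → ℝ) : ℂ → ℝ :=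
  (complexToPlane x₀ ⁻¹' Ω).indicator (f ∘ complexToPlane x₀)

theorem measurableSet_preimage_complexToPlane : MeasurableSet (complexToPlane x₀ ⁻¹' Ω) :=
  (Ω.isOpen.preimage (complexToPlane x₀).continuous).measurableSet

theorem setIntegral_comp_complexToPlane (f : Plane → ℝ) :
    ∫ z in complexToPlane x₀ ⁻¹' Ω, f (complexToPlane x₀ z) = ∫ x in Ω, f x :=
  measurePreserving_complexToPlane.setIntegral_preimage_emb
    (complexToPlane x₀).measurableEmbedding f Ω

theorem integral_pullback_mul (f : Plane → ℝ) (k : ℂ → ℝ) :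
    ∫ z, pullback x₀ Ω f z * k z = ∫ x in Ω, f x * k ((complexToPlane x₀).symm x) := by
  rw [← setIntegral_comp_complexToPlane (x₀ := x₀),
    ← integral_indicator measurableSet_preimage_complexToPlane]
  refine integral_congr_ae (Filter.Eventually.of_forall fun z => ?_)
  by_cases hz : z ∈ complexToPlane x₀ ⁻¹' Ω
  · simp only [pullback, Set.indicator_of_mem hz, Function.comp_apply, Homeomorph.symm_apply_apply]
  · simp only [pullback, Set.indicator_of_notMem hz, zero_mul]

theorem integrable_pullback {f : Plane → ℝ} (hf : Integrable f (domainMeasure Ω)) :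
    Integrable (pullback x₀ Ω f) := by
  refine IntegrableOn.integrable_indicator ?_ measurableSet_preimage_complexToPlane
  exact (measurePreserving_complexToPlane.integrableOn_comp_preimage
    (complexToPlane x₀).measurableEmbedding).2 hf

theorem pullback_sq (f : Plane → ℝ) :
    (fun z => pullback x₀ Ω f z ^ 2) = pullback x₀ Ω fun x => f x ^ 2 := by
  funext z
  by_cases hz : z ∈ complexToPlane x₀ ⁻¹' Ω
  · simp only [pullback, Set.indicator_of_mem hz, Function.comp_apply]
  · simp [pullback, Set.indicator_of_notMem hz]

theorem integral_pullback (f : Plane → ℝ) : ∫ z, pullback x₀ Ω f z = ∫ x in Ω, f x := by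
  have := integral_pullback_mul (x₀ := x₀) (Ω := Ω) f fun _ => 1
  simpa using this

theorem norm_sq_eq_integral (f : L2 Ω) : ‖f‖ ^ 2 = ∫ x in Ω, f x ^ 2 := by
  rw [← real_inner_self_eq_norm_sq, L2.inner_def]
  simp

theorem isWeaklyHolomorphicOn_pullback {h g : L2 Ω}
    (H : ∀ φ : Fin 2 → 𝓓(Ω, ℝ), ⟪h, matrixDiv (testGrad φ)⟫ = ⟪g, matrixCurl (testGrad φ)⟫) :
    IsWeaklyHolomorphicOn (complexToPlane x₀ ⁻¹' Ω) (pullback x₀ Ω h) (pullback x₀ Ω g) := by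
  intro ψ hψ hψc hψS
  have hsymm : ContDiff ℝ ∞ (complexToPlane x₀).symm := by
    have : ((complexToPlane x₀).symm : Plane → ℂ) =
        fun x => Complex.orthonormalBasisOneI.repr.symm (x - x₀) :=
      funext complexToPlane_symm_apply
    rw [this]
    exact Complex.orthonormalBasisOneI.repr.symm.contDiff.comp (contDiff_id.sub contDiff_const)
  let φ : 𝓓(Ω, ℝ) := ⟨ψ ∘ (complexToPlane x₀).symm, hψ.comp hsymm,
    hψc.comp_homeomorph _, by
      rw [tsupport_comp_eq_preimage]
      intro x hx
      have := hψS hx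
      simpa using this⟩
  have hpull : ∀ (f : Plane → ℝ) (i : Fin 2),
      ∫ z, pullback x₀ Ω f z * fderiv ℝ ψ z (Complex.orthonormalBasisOneI i) =
        ∫ x in Ω, f x * testDeriv i φ x := fun f i => by
    rw [integral_pullback_mul]
    refine integral_congr_ae (Filter.Eventually.of_forall fun x => ?_)
    have e := partialDeriv_comp_complexToPlane_symm (x₀ := x₀) (hψ.differentiable (by simp)) i
      ((complexToPlane x₀).symm x)
    rw [Homeomorph.apply_symm_apply] at e
    dsimp only
    rw [testDeriv_apply, ← e]
    rfl
  have b0 : Complex.orthonormalBasisOneI 0 = 1 := by simp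
  have b1 : Complex.orthonormalBasisOneI 1 = Complex.I := by simp
  have h0 := hpull h 0
  have h1 := hpull h 1
  have g0 := hpull g 0
  have g1 := hpull g 1
  rw [b0] at h0 g0
  rw [b1] at h1 g1
  rw [h0, h1, g0, g1]
  simp only [← inner_testToL2]
  -- The two coordinate fields give the two Cauchy-Riemann equations.
  have H1 := H ![φ, 0]
  have H2 := H ![0, φ]
  simp only [matrixDiv_apply, matrixCurl_apply, testGrad_apply, Matrix.cons_val_zero,
    Matrix.cons_val_one, map_zero, add_zero, zero_add, zero_sub, sub_zero, inner_neg_right] at H1 H2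
  exact ⟨H1, H2⟩

/-- The Friedrichs inequality on a star-shaped plane domain. -/
theorem friedrichs_plane (hρ : 0 < ρ) (hu0 : 0 ≤ u) (hu1 : u < 1)
    (hρR : ρ ^ 2 = R ^ 2 * (1 - u ^ 2)) (hR : (Ω : Set Plane) ⊆ Metric.closedBall x₀ R)
    (hstar : IsStarShapedWrtBall (Ω : Set Plane) x₀ ρ) {h g : L2 Ω} (hmean : ∫ x in Ω, h x = 0)
    (H : ∀ φ : Fin 2 → 𝓓(Ω, ℝ), ⟪h, matrixDiv (testGrad φ)⟫ = ⟪g, matrixCurl (testGrad φ)⟫) :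
    (1 - u) * ‖h‖ ^ 2 ≤ (1 + u) * ‖g‖ ^ 2 := by
  have hfin : IsFiniteMeasure (domainMeasure Ω) := ⟨by
    rw [Measure.restrict_apply_univ]
    exact (measure_mono hR).trans_lt measure_closedBall_lt_top⟩
  have hint : ∀ f : L2 Ω, Integrable f (domainMeasure Ω) := fun f =>
    (Lp.memLp f).integrable one_le_two
  have hint2 : ∀ f : L2 Ω, Integrable (fun x => f x ^ 2) (domainMeasure Ω) := fun f =>
    (Lp.memLp f).integrable_sq
  have hball : ∀ y ∈ Metric.ball (0 : ℂ) ρ, complexToPlane x₀ y ∈ Metric.ball x₀ ρ := fun y hy => by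
    rwa [Metric.mem_ball, dist_complexToPlane, ← mem_ball_zero_iff]
  have key := friedrichs_of_isWeaklyHolomorphicOn (S := complexToPlane x₀ ⁻¹' Ω)
    (h := pullback x₀ Ω h) (g := pullback x₀ Ω g) hρ hu0 hu1 hρR
    (Ω.isOpen.preimage (complexToPlane x₀).continuous)
    (fun y hy => hstar.ball_subset (hball y hy))
    (fun y hy x hx w hw => hstar.segment_subset _ (hball y hy) _ hx
      (complexToPlane_segment_subset y x ⟨w, hw, rfl⟩))
    (fun z hz => by
      rw [mem_closedBall_zero_iff, ← dist_complexToPlane (x₀ := x₀)]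
      exact hR hz)
    (integrable_pullback (hint h)) (by rw [pullback_sq]; exact integrable_pullback (hint2 h))
    (integrable_pullback (hint g)) (by rw [pullback_sq]; exact integrable_pullback (hint2 g))
    (isWeaklyHolomorphicOn_pullback H)
    (by
      rw [← hmean, ← integral_pullback (x₀ := x₀), ← integral_indicator
        measurableSet_preimage_complexToPlane, pullback, Set.indicator_indicator, Set.inter_self])
  have hle : ∫ z in complexToPlane x₀ ⁻¹' Ω, pullback x₀ Ω h z ^ 2 = ∫ x in Ω, h x ^ 2 := by
    rw [← setIntegral_comp_complexToPlane (x₀ := x₀)]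
    refine setIntegral_congr_fun measurableSet_preimage_complexToPlane fun z hz => ?_
    simp only [pullback, Set.indicator_of_mem hz, Function.comp_apply]
  rwa [hle, pullback_sq, integral_pullback, ← norm_sq_eq_integral, ← norm_sq_eq_integral] at key

end Transfer

/-! ### The bound for the inf-sup constant -/

/-- Test fields alone suffice as competitors in the supremum. Since they only come within any `b`
below the constant, the bound is proved for each real `b < √((1 - u) / 2)`. -/
theorem le_infSupConstant {Ω : Opens Plane} {x₀ : Plane} {ρ R u : ℝ} (hρ : 0 < ρ) (hu0 : 0 ≤ u)
    (hu1 : u < 1) (hρR : ρ ^ 2 = R ^ 2 * (1 - u ^ 2))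
    (hR : (Ω : Set Plane) ⊆ Metric.closedBall x₀ R)
    (hstar : IsStarShapedWrtBall (Ω : Set Plane) x₀ ρ) :
    ((√((1 - u) / 2) : ℝ) : EReal) ≤ infSupConstant Ω := by
  have hfin : volume (Ω : Set Plane) < ⊤ := (measure_mono hR).trans_lt measure_closedBall_lt_top
  have hfin' : domainMeasure Ω Set.univ ≠ ⊤ := by
    rw [Measure.restrict_apply_univ]
    exact hfin.ne
  set one : L2 Ω := indicatorConstLp 2 MeasurableSet.univ hfin' (1 : ℝ) with hone_def
  have hone : ∀ f : L2 Ω, inner ℝ one f = ∫ x in Ω, f x := fun f => by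
    rw [hone_def, L2.inner_indicatorConstLp_one, Measure.restrict_univ]
  refine le_iInf fun q => le_iInf fun hq1 => le_iInf fun hq => ?_
  refine le_of_forall_lt fun a ha => ?_
  obtain ⟨b, hab, hb⟩ := EReal.lt_iff_exists_real_btwn.1 ha
  refine hab.trans_le ?_
  obtain ⟨w, ⟨φ, rfl⟩, hw0, hw⟩ := exists_infSup_of_friedrichs (A := LinearMap.range testGrad)
    (d := matrixDiv) (c := matrixCurl) (one := one) (q := q)
    (by rintro _ ⟨φ, rfl⟩ _ ⟨ψ, rfl⟩; exact inner_testGrad φ ψ)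
    (by
      rintro _ ⟨φ, rfl⟩
      have e : ∀ ψ : 𝓓(Ω, ℝ), inner ℝ one (testToL2 ψ) = ∫ x in Ω, ψ x := fun ψ => by
        rw [hone]
        exact integral_congr_ae (coeFn_testToL2 ψ)
      rw [matrixDiv_apply, inner_add_right, testGrad_apply, testGrad_apply, e, e, integral_testDeriv,
        integral_testDeriv, add_zero])
    (by rw [hone, hq1]) (by simpa using hq) hu0 hu1
    (fun h g hmean H => friedrichs_plane hρ hu0 hu1 hρR hR hstar (by rw [← hone, hmean])
      fun φ => H _ ⟨φ, rfl⟩)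
    (EReal.coe_lt_coe_iff.1 hb)
  refine le_iSup₂_of_le (fun k => testToH10 (φ k))
    (by rw [gradNorm_testToH10]; exact norm_ne_zero_iff.2 hw0) ?_
  rw [EReal.coe_le_coe_iff, gradNorm_testToH10, divergence_testToH10]
  refine hw.trans_eq ?_
  congr 1
  rw [L2.inner_def]
  exact integral_congr_ae (Filter.Eventually.of_forall fun x => mul_comm _ _)

theorem theorem3 (Ω : Opens Plane) (x₀ : Plane) (ρ R : ℝ) (hρ : 0 < ρ)
    (hR : (Ω : Set Plane) ⊆ Metric.closedBall x₀ R)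
    (hstar : IsStarShapedWrtBall (Ω : Set Plane) x₀ ρ) :
    ((ρ / (√2 * R) * (1 + √(1 - ρ ^ 2 / R ^ 2)) ^ (-(1 / 2) : ℝ) : ℝ) : EReal)
        ≤ infSupConstant Ω ∧
      ρ / (2 * R) ≤ ρ / (√2 * R) * (1 + √(1 - ρ ^ 2 / R ^ 2)) ^ (-(1 / 2) : ℝ) ∧
      ((Real.sin ((Real.pi / 2 - Real.arccos (ρ / R)) / 2) : ℝ) : EReal) ≤ infSupConstant Ω ∧
      Real.sin ((Real.pi / 2 - Real.arccos (ρ / R)) / 2) =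
        ρ / (√2 * R) * (1 + √(1 - ρ ^ 2 / R ^ 2)) ^ (-(1 / 2) : ℝ) := by
  -- The open ball lies in the closed one; points at distance `(d + ρ) / 2` from `x₀`, with `d < ρ`
  -- arbitrarily close to `ρ`, force `ρ ≤ R`.
  have hle : ρ ≤ R := by
    refine le_of_forall_lt fun c hc => ?_
    set d := max c 0
    have hd0 : 0 ≤ d := le_max_right _ _
    have hd : d < ρ := max_lt hc hρ
    set y : Plane := x₀ + EuclideanSpace.single 0 ((d + ρ) / 2) with hy
    have hdist : dist y x₀ = (d + ρ) / 2 := by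
      rw [hy, dist_eq_norm, add_sub_cancel_left, PiLp.norm_single, Real.norm_of_nonneg]
      linarith
    have h1 : y ∈ Metric.ball x₀ ρ := by rw [Metric.mem_ball, hdist]; linarith
    have h2 := hR (hstar.ball_subset h1)
    rw [Metric.mem_closedBall, hdist] at h2
    have : c ≤ d := le_max_left _ _
    linarith
  have hRpos : 0 < R := hρ.trans_le hle
  set x := ρ / R with hx
  have hx0 : 0 < x := div_pos hρ hRpos
  have hx1 : x ≤ 1 := (div_le_one hRpos).2 hle
  rw [← div_pow, ← hx]
  set u := √(1 - x ^ 2) with hu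
  have hu0 : 0 ≤ u := Real.sqrt_nonneg _
  have husq : u ^ 2 = 1 - x ^ 2 := Real.sq_sqrt (by nlinarith)
  have hu1 : u < 1 := by nlinarith [pow_pos hx0 2]
  have hρR : ρ ^ 2 = R ^ 2 * (1 - u ^ 2) := by
    rw [husq, hx]; field_simp; ring
  have hval : ρ / (√2 * R) * (1 + u) ^ (-(1 / 2) : ℝ) = √((1 - u) / 2) := by
    have h1 : (1 + u) ^ (-(1 / 2) : ℝ) = (√(1 + u))⁻¹ := by
      rw [Real.rpow_neg (by linarith), Real.sqrt_eq_rpow]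
    have h2 : ρ / (√2 * R) = x / √2 := by rw [hx]; field_simp
    rw [h1, h2]
    symm
    rw [Real.sqrt_eq_iff_mul_self_eq_of_pos (by positivity), ← pow_two, mul_pow, div_pow, inv_pow, Real.sq_sqrt (by norm_num), Real.sq_sqrt (by linarith)]
    have : x ^ 2 = (1 - u) * (1 + u) := by linarith
    rw [this]
    field_simp
  have hsin : Real.sin ((Real.pi / 2 - Real.arccos x) / 2) = √((1 - u) / 2) := by
    rw [← Real.arcsin_eq_pi_div_two_sub_arccos, Real.sin_half_eq_sqrt, Real.cos_arcsin]
    · exact Real.arcsin_nonneg.2 hx0.le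
    · linarith [Real.arcsin_le_pi_div_two x, Real.pi_pos]
  have hβ := le_infSupConstant hρ hu0 hu1 hρR hR hstar
  rw [hval, hsin]
  refine ⟨hβ, ?_, hβ, rfl⟩
  -- With `x² = (1 - u) (1 + u)` the claim `x² / 4 ≤ (1 - u) / 2` reduces to `1 + u ≤ 2`.
  refine Real.le_sqrt_of_sq_le ?_
  have h3 : ρ / (2 * R) = x / 2 := by rw [hx]; field_simp
  rw [h3]
  nlinarith
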